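/- For $0<\alpha\le 2$, $\alpha\neq 1$, and $F>0$, let $S(\alpha,1,F)$ denote the maximally skewed $\alpha$-stable law on $\mathbb{R}$, that is, the law with characteristic function $$t\mapsto \exp\Big(-F|t|^{\alpha}\big(1-\sqrt{-1}\,\mathrm{sign}(t)\tan(\tfrac{\pi\alpha}{2})\big)\Big).$$ Let $0<q<1$. Let $F_Z(z)=P(|X|\le z)$ be the distribution function of $Z=|X|$ for $X\sim S(\alpha,1,1)$, let $f_Z=F_Z'$ be its density, and let $W_q=F_Z^{-1}(q)$ be its $q$-quantile. Then $F_Z$ takes the value $q$ at exactly one point $W_q$, $W_q>0$, and $F_Z$ is differentiable there with $f_Z(W_q)>0$. For i.i.d. samples $x_1,\dots,x_k\sim S(\alpha,1,F_{(\alpha)})$, where $F_{(\alpha)}>0$, let the quantile estimator be $$\hat F_{(\alpha),q}=\left(\frac{q\text{-Quantile}\{|x_j|,\ j=1,\dots,k\}}{W_q}\right)^{\alpha},$$ where the sample $q$-quantile is the $\lceil qk\rceil$-th smallest of $|x_1|,\dots,|x_k|$. Then, for all sufficiently large $k$, $\hat F_{(\alpha),q}$ has a finite second moment, and as $k\to\infty$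 $$\mathrm{Var}\big(\hat F_{(\alpha),q}\big)=\frac{F_{(\alpha)}^2}{k}\,\frac{(q-q^2)\,\alpha^2}{f_Z\big(F_Z^{-1}(q)\big)^2\,\big(F_Z^{-1}(q)\big)^2}+O\!\left(\frac1{k^2}\right),$$ where the constant in $O(1/k^2)$ (and the threshold on $k$) depends only on $\alpha$, $q$ and $F_{(\alpha)}$. -/

import Mathlib

open MeasureTheory ProbabilityTheory

noncomputable section

/-- `μ` is the stable law `S(α, β, F)`: the probability measure on `ℝ` with characteristic function
`t ↦ exp (-F |t|^α (1 - i β sign(t) tan (π α / 2)))`. Maximal skewness is `β = 1`. -/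
def IsStableLaw (α β F : ℝ) (μ : Measure ℝ) : Prop :=
  IsProbabilityMeasure μ ∧
    ∀ t : ℝ, charFun μ t =
      Complex.exp (-((F * |t| ^ α : ℝ) : ℂ) *
        (1 - Complex.I * ((β * Real.sign t * Real.tan (Real.pi * α / 2) : ℝ) : ℂ)))

/-- The distribution function `z ↦ P(|X| ≤ z)` of `Z = |X|`, where `X` has law `μ`. -/
def absCDF (μ : Measure ℝ) (z : ℝ) : ℝ := μ.real {x : ℝ | |x| ≤ z}

/-- The density of `Z = |X|`, where `X` has law `μ`, as the pointwise derivative of the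
distribution function. -/
def absDensity (μ : Measure ℝ) (z : ℝ) : ℝ := deriv (absCDF μ) z

/-- The `q`-quantile of `Z = |X|`, where `X` has law `μ`: the inverse of the distribution
function of `Z` at `q`. -/
def absQuantile (μ : Measure ℝ) (q : ℝ) : ℝ := sInf {z : ℝ | q ≤ absCDF μ z}

/-- The `r`-th smallest (`1 ≤ r ≤ k`) of the numbers `y 0, …, y (k - 1)`, with repetitions: the
least `t` such that at least `r` of the numbers are `≤ t`. -/
def orderStatistic {k : ℕ} (y : Fin k → ℝ) (r : ℕ) : ℝ :=
  sInf {t : ℝ | r ≤ (Finset.univ.filter fun j => y j ≤ t).card}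

/-- The sample `q`-quantile of `y 0, …, y (k - 1)`: the `(q k)`-th smallest of these numbers,
with `q k` rounded up when it is not an integer. -/
def sampleQuantile {k : ℕ} (q : ℝ) (y : Fin k → ℝ) : ℝ := orderStatistic y ⌈q * (k : ℝ)⌉₊

/-- The quantile estimator `(q-Quantile {|x j|} / W_q) ^ α`, where `W_q` is the `q`-quantile of
`|X|` for `X` with law `ν`; the law `ν` is meant to be `S(α, 1, 1)`. -/
def quantileEstimator (α q : ℝ) (ν : Measure ℝ) {k : ℕ} (x : Fin k → ℝ) : ℝ :=
  (sampleQuantile q (fun j => |x j|) / absQuantile ν q) ^ α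

end

/-!
The sample quantile of `|x₁|, …, |x_k|` is the quantile transform of a beta variable, so the variance
asymptotics reduce to a delta method for `Beta (⌈q k⌉, k - ⌈q k⌉ + 1)`.

The analytic input concerns a single stable law. Its characteristic function decays like
`exp (-F |t| ^ α)`, so Fourier inversion (`eq_withDensity_inversionDensity`) gives a smooth density
`p`. The density `p z + p (-z)` of `|X|` is positive for `z > 0`: strict stability, which is where
`α ≠ 1` enters, makes the open set `{p > 0}` closed under, and exhausted by, the combinations
`a x + b y` with `a ^ α + b ^ α = 1`, and such a set contains each half-line that it meets
(`Ioi_subset_of_rpow_combinations`). Hence the distribution function `G` of `|X|` is a smooth strictly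
increasing function on the positive half-line, with a smooth inverse `Q` on the unit interval. As the
characteristic function is `1 + O(|t| ^ α)`, the tail satisfies `1 - G z = O(z ^ (-α))`, that is,
`Q u ^ α = O((1 - u)⁻¹)`.

Put `h u = (Q u / W) ^ α` with `W = Q q`. Taylor's formula at `q` and the tail bound give, on the whole
unit interval, `h u = 1 + a (u - q) + c (u - q) ^ 2 + O(|u - q| ^ 3 (1 - u)⁻¹)`, where
`a = α / (f_Z W · W)` (`IsStableLaw.exists_quantile_expansion`). By scaling, the estimator has the law
of `F h(Y)` with `Y` beta distributed (`IsStableLaw.map_orderStatistic_abs_pi`): the distribution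
function of an order statistic is an upper binomial tail, whose derivative telescopes to a beta
density. The weight `(1 - u) ^ (-2)` only lowers the second parameter of the beta law by `2`, at
the cost of a bounded factor, so the explicit moments of beta laws bound all error terms. The error is
`O(k ^ (-2))` and not merely `O(k ^ (-3 / 2))` because the third moment of `Y - q` is of that order.
-/

open Set Filter Topology FourierTransform

/-! ### Fourier inversion for probability measures -/

/-- The value at `x` of the Fourier inversion integral of the characteristic function of `μ`. When
the characteristic function is integrable this is the continuous density of `μ`. -/
noncomputable def inversionDensity (μ : Measure ℝ) (x : ℝ) : ℝ :=
  (𝓕 (fun ξ : ℝ => charFun μ (2 * Real.pi * ξ)) x).re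

lemma integrable_charFun_two_pi {μ : Measure ℝ} (hμ : Integrable (charFun μ)) :
    Integrable (fun ξ : ℝ => charFun μ (2 * Real.pi * ξ)) :=
  hμ.comp_mul_left' (by positivity)

lemma continuous_fourier_charFun {μ : Measure ℝ} (hμ : Integrable (charFun μ)) :
    Continuous (𝓕 (fun ξ : ℝ => charFun μ (2 * Real.pi * ξ))) :=
  VectorFourier.fourierIntegral_continuous Real.continuous_fourierChar
    (by exact continuous_inner) (integrable_charFun_two_pi hμ)

lemma continuous_inversionDensity {μ : Measure ℝ} (hμ : Integrable (charFun μ)) :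
    Continuous (inversionDensity μ) :=
  Complex.continuous_re.comp (continuous_fourier_charFun hμ)

lemma norm_fourier_charFun_le (μ : Measure ℝ) (x : ℝ) :
    ‖𝓕 (fun ξ : ℝ => charFun μ (2 * Real.pi * ξ)) x‖
      ≤ ∫ ξ : ℝ, ‖charFun μ (2 * Real.pi * ξ)‖ :=
  VectorFourier.norm_fourierIntegral_le_integral_norm _ _ _ _ _

lemma abs_inversionDensity_le (μ : Measure ℝ) (x : ℝ) :
    |inversionDensity μ x| ≤ ∫ ξ : ℝ, ‖charFun μ (2 * Real.pi * ξ)‖ :=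
  (Complex.abs_re_le_norm _).trans (norm_fourier_charFun_le μ x)

lemma charFun_two_pi_eq_fourierIntegral (μ : Measure ℝ) (ξ : ℝ) :
    charFun μ (2 * Real.pi * ξ)
      = VectorFourier.fourierIntegral Real.fourierChar μ (innerₗ ℝ) 1 (-ξ) := by
  rw [charFun_eq_fourierIntegral']
  congr 1
  simp only [smul_eq_mul]
  field_simp

/-- Testing `μ` against a smooth compactly supported `g` is testing the inversion density: write `g`
as the Fourier transform of a Schwartz function and use that the Fourier transform is
self-adjoint, once against `μ` and once against Lebesgue measure. -/
lemma integral_eq_integral_mul_inversionDensity {μ : Measure ℝ} [IsProbabilityMeasure μ]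
    (hμ : Integrable (charFun μ)) {g : ℝ → ℝ}
    (hg : ContDiff ℝ (⊤ : ℕ∞) g) (hgc : HasCompactSupport g) :
    ∫ x, g x ∂μ = ∫ x, g x * inversionDensity μ x := by
  set ψ : ℝ → ℂ := fun ξ : ℝ => charFun μ (2 * Real.pi * ξ) with hψ
  have hψi : Integrable ψ := integrable_charFun_two_pi hμ
  have hGc : HasCompactSupport (fun x => (g x : ℂ)) := hgc.comp_left (g := Complex.ofReal) rfl
  have hGs : ContDiff ℝ (⊤ : ℕ∞) (fun x => (g x : ℂ)) := Complex.ofRealCLM.contDiff.comp hg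
  let G : SchwartzMap ℝ ℂ := hGc.toSchwartzMap hGs
  have hG : ∀ x, G x = (g x : ℂ) := fun x => rfl
  have hinv : 𝓕 (𝓕⁻ G) = G := FourierTransform.fourier_fourierInv_eq G
  have h1 : ∫ x, G x ∂μ = ∫ ξ, (𝓕⁻ G) ξ * ψ (-ξ) := by
    conv_lhs => rw [← hinv]
    have := VectorFourier.integral_fourierIntegral_smul_eq_flip (μ := volume) (ν := μ)
      (e := Real.fourierChar) (L := innerₗ ℝ) (f := (𝓕⁻ G : SchwartzMap ℝ ℂ)) (g := (1 : ℝ → ℂ))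
      Real.continuous_fourierChar (by exact continuous_inner)
      ((𝓕⁻ G).integrable) (integrable_const 1)
    simp only [Pi.one_apply, smul_eq_mul, mul_one] at this
    refine this.trans ?_
    refine integral_congr_ae (Eventually.of_forall fun ξ => ?_)
    simp only [hψ]
    rw [charFun_two_pi_eq_fourierIntegral, neg_neg, flip_innerₗ]
  have h2 : ∫ ξ, (𝓕⁻ G) ξ * ψ (-ξ) = ∫ ξ, (𝓕 G) ξ * ψ ξ := by
    refine Eq.trans ?_ (integral_neg_eq_self (fun ξ => (𝓕 G) ξ * ψ ξ) volume)
    refine integral_congr_ae (Eventually.of_forall fun ξ => ?_)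
    simp only
    rw [SchwartzMap.fourierInv_coe, SchwartzMap.fourier_coe, Real.fourierInv_eq_fourier_neg]
  have h3 : ∫ ξ, (𝓕 G) ξ * ψ ξ = ∫ x, G x * 𝓕 ψ x := by
    have := VectorFourier.integral_fourierIntegral_smul_eq_flip (μ := volume) (ν := volume)
      (e := Real.fourierChar) (L := innerₗ ℝ) (f := (G : ℝ → ℂ)) (g := ψ)
      Real.continuous_fourierChar (by exact continuous_inner) G.integrable hψi
    rw [flip_innerₗ] at this
    exact this
  have h4 : Integrable (fun x => G x * 𝓕 ψ x) := by
    refine G.integrable.mul_bdd (c := ∫ ξ, ‖ψ ξ‖)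
      (continuous_fourier_charFun hμ).aestronglyMeasurable
      (Eventually.of_forall fun x => norm_fourier_charFun_le μ x)
  have h5 : ((∫ x, g x ∂μ : ℝ) : ℂ) = ∫ x, G x * 𝓕 ψ x := by
    rw [← h3, ← h2, ← h1, ← integral_complex_ofReal]
    rfl
  have h6 := congrArg Complex.re h5
  rw [Complex.ofReal_re] at h6
  rw [h6, ← RCLike.re_eq_complex_re, ← integral_re h4]
  refine integral_congr_ae (Eventually.of_forall fun x => ?_)
  simp only [hG, RCLike.re_eq_complex_re, Complex.re_ofReal_mul]
  rfl

/-- Smooth bumps increasing to the indicator of a ball turn the test function identity into the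
mass of the ball. -/
lemma measureReal_ball_eq_integral_inversionDensity {μ : Measure ℝ} [IsProbabilityMeasure μ]
    (hμ : Integrable (charFun μ)) (c : ℝ) {r : ℝ} (hr : 0 < r) :
    μ.real (Metric.ball c r) = ∫ x in Metric.ball c r, inversionDensity μ x := by
  let b : ℕ → ContDiffBump c := fun n =>
    { rIn := r * (1 - 1 / ((n : ℝ) + 2))
      rOut := r
      rIn_pos := by
        have : 1 / ((n : ℝ) + 2) < 1 := by
          rw [div_lt_one (by positivity)]; linarith [Nat.cast_nonneg (α := ℝ) n]
        exact mul_pos hr (by linarith)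
      rIn_lt_rOut := by
        have : 0 < 1 / ((n : ℝ) + 2) := by positivity
        nlinarith }
  have hbIn : ∀ n, (b n).rIn = r * (1 - 1 / ((n : ℝ) + 2)) := fun n => rfl
  have hbOut : ∀ n, (b n).rOut = r := fun n => rfl
  have hle : ∀ n x, ‖b n x‖ ≤ (Metric.ball c r).indicator (fun _ => (1 : ℝ)) x := by
    intro n x
    rw [Real.norm_of_nonneg (b n).nonneg]
    by_cases hx : x ∈ Metric.ball c r
    · rw [indicator_of_mem hx]; exact (b n).le_one
    · rw [indicator_of_notMem hx]
      have : x ∉ Function.support (b n) := by rwa [(b n).support_eq, hbOut]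
      simp only [Function.mem_support, not_not] at this
      exact this.le
  have hlim : ∀ x, Tendsto (fun n => b n x) atTop
      (𝓝 ((Metric.ball c r).indicator (fun _ => (1 : ℝ)) x)) := by
    intro x
    by_cases hx : x ∈ Metric.ball c r
    · rw [indicator_of_mem hx]
      have hl : Tendsto (fun n : ℕ => r * (1 - 1 / ((n : ℝ) + 2))) atTop (𝓝 (r * (1 - 0))) := by
        refine Tendsto.const_mul _ (Tendsto.const_sub _ ?_)
        have := (tendsto_natCast_atTop_atTop (R := ℝ)).atTop_add (tendsto_const_nhds (x := (2 : ℝ)))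
        simpa only [one_div] using! this.inv_tendsto_atTop
      have hx' : dist x c < r * (1 - 0) := by simpa using hx
      refine tendsto_const_nhds.congr' ?_
      filter_upwards [hl.eventually (lt_mem_nhds hx')] with n hn
      exact ((b n).one_of_mem_closedBall (by rw [Metric.mem_closedBall, hbIn]; exact hn.le)).symm
    · rw [indicator_of_notMem hx]
      refine tendsto_const_nhds.congr fun n => ?_
      have : x ∉ Function.support (b n) := by rwa [(b n).support_eq, hbOut]
      simpa using (Function.notMem_support.mp this).symm
  have hL : Tendsto (fun n => ∫ x, b n x ∂μ) atTop (𝓝 (μ.real (Metric.ball c r))) := by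
    have h := tendsto_integral_of_dominated_convergence (μ := μ) (F := fun n x => b n x)
      (f := (Metric.ball c r).indicator (fun _ => (1 : ℝ)))
      (fun x => (Metric.ball c r).indicator (fun _ => (1 : ℝ)) x)
      (fun n => (b n).continuous.aestronglyMeasurable)
      ((integrable_const (1 : ℝ)).indicator measurableSet_ball)
      (fun n => Eventually.of_forall (hle n)) (Eventually.of_forall hlim)
    have h1 := integral_indicator_one (μ := μ) (measurableSet_ball (x := c) (ε := r))
    exact h1 ▸ h
  have hR : Tendsto (fun n => ∫ x, b n x * inversionDensity μ x) atTop
      (𝓝 (∫ x in Metric.ball c r, inversionDensity μ x)) := by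
    rw [← integral_indicator measurableSet_ball]
    refine tendsto_integral_of_dominated_convergence
      (fun x => (Metric.ball c r).indicator (fun _ => ∫ ξ : ℝ, ‖charFun μ (2 * Real.pi * ξ)‖) x)
      (fun n => ((b n).continuous.mul (continuous_inversionDensity hμ)).aestronglyMeasurable)
      ?_ ?_ ?_
    · rw [integrable_indicator_iff measurableSet_ball]
      exact integrableOn_const measure_ball_lt_top.ne
    · intro n
      refine Eventually.of_forall fun x => ?_
      rw [norm_mul]
      have h1 := hle n x
      have h2 := abs_inversionDensity_le μ x
      by_cases hx : x ∈ Metric.ball c r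
      · rw [indicator_of_mem hx] at h1 ⊢
        calc _ ≤ 1 * _ := mul_le_mul h1 h2 (abs_nonneg _) zero_le_one
          _ = _ := one_mul _
      · rw [indicator_of_notMem hx] at h1 ⊢
        rw [le_antisymm h1 (norm_nonneg _), zero_mul]
    · refine Eventually.of_forall fun x => ?_
      have := (hlim x).mul_const (inversionDensity μ x)
      convert this using 2
      by_cases hx : x ∈ Metric.ball c r
      · simp [indicator_of_mem hx]
      · simp [indicator_of_notMem hx]
  refine tendsto_nhds_unique hL (hR.congr fun n => ?_)
  exact (integral_eq_integral_mul_inversionDensity hμ (b n).contDiff (b n).hasCompactSupport).symm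

lemma inversionDensity_nonneg {μ : Measure ℝ} [IsProbabilityMeasure μ]
    (hμ : Integrable (charFun μ)) (x : ℝ) : 0 ≤ inversionDensity μ x := by
  by_contra! hx
  obtain ⟨r, hr, hball⟩ := Metric.mem_nhds_iff.mp
    ((continuous_inversionDensity hμ).continuousAt.eventually (gt_mem_nhds hx))
  have h1 := measureReal_ball_eq_integral_inversionDensity hμ x hr
  have h2 : ∫ y in Metric.ball x r, inversionDensity μ y < 0 := by
    have hint : IntegrableOn (inversionDensity μ) (Metric.ball x r) :=
      ((continuous_inversionDensity hμ).integrableOn_Icc (a := x - r) (b := x + r)).mono_set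
        (by rw [← Real.closedBall_eq_Icc]; exact Metric.ball_subset_closedBall)
    have : 0 < ∫ y in Metric.ball x r, -inversionDensity μ y := by
      refine (setIntegral_pos_iff_support_of_nonneg_ae ?_ hint.neg).mpr ?_
      rotate_left
      · refine (Metric.measure_ball_pos volume x hr).trans_le (measure_mono fun y hy => ?_)
        have := hball hy
        simp only [mem_ofPred_eq] at this
        exact ⟨by simp [this.ne], hy⟩
      · filter_upwards [ae_restrict_mem measurableSet_ball] with y hy
        have := hball hy
        simp only [mem_ofPred_eq] at this
        simpa using this.le
    rw [integral_neg] at this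
    linarith
  linarith [measureReal_nonneg (μ := μ) (s := Metric.ball x r)]

/-- **Fourier inversion for measures**: a probability measure with integrable characteristic
function has the inversion density. -/
theorem eq_withDensity_inversionDensity {μ : Measure ℝ} [IsProbabilityMeasure μ]
    (hμ : Integrable (charFun μ)) :
    μ = volume.withDensity (fun x => ENNReal.ofReal (inversionDensity μ x)) := by
  have hc := continuous_inversionDensity hμ
  refine Real.measure_ext_Ioo_rat fun p q => ?_
  rcases le_or_gt (q : ℝ) p with h | h
  · simp [Ioo_eq_empty (not_lt.mpr h)]
  rw [withDensity_apply _ measurableSet_Ioo]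
  have hr : 0 < ((q : ℝ) - p) / 2 := by linarith
  have h1 := measureReal_ball_eq_integral_inversionDensity hμ (((p : ℝ) + q) / 2) hr
  have h2 : Metric.ball (((p : ℝ) + q) / 2) (((q : ℝ) - p) / 2) = Ioo (p : ℝ) q := by
    rw [Real.ball_eq_Ioo]; congr 1 <;> ring
  rw [h2] at h1
  rw [← ofReal_integral_eq_lintegral_ofReal
    ((hc.integrableOn_Icc (a := (p : ℝ)) (b := q)).mono_set Ioo_subset_Icc_self)
    (Eventually.of_forall fun x => inversionDensity_nonneg hμ x), ← h1, ofReal_measureReal]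

/-- The inversion density of a convolution is the average of the translates of the inversion
density of one of the factors. -/
lemma inversionDensity_eq_integral_of_charFun_eq_mul {μ ρ κ : Measure ℝ}
    [IsProbabilityMeasure κ] (hρ : Integrable (charFun ρ))
    (h : ∀ t, charFun μ t = charFun ρ t * charFun κ t) (z : ℝ) :
    inversionDensity μ z = ∫ y, inversionDensity ρ (z - y) ∂κ := by
  have hi := integrable_charFun_two_pi hρ
  have hcont : Continuous fun y => 𝓕 (fun ξ : ℝ => charFun ρ (2 * Real.pi * ξ)) (z - y) :=
    (continuous_fourier_charFun hρ).comp (by fun_prop)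
  have hint : Integrable (fun y => 𝓕 (fun ξ : ℝ => charFun ρ (2 * Real.pi * ξ)) (z - y)) κ :=
    Integrable.of_bound hcont.aestronglyMeasurable _
      (Eventually.of_forall fun y => norm_fourier_charFun_le ρ (z - y))
  unfold inversionDensity
  rw [← RCLike.re_eq_complex_re, integral_re hint]
  congr 1
  have hf : Integrable (fun ξ : ℝ => Real.fourierChar (-(inner ℝ ξ z)) •
      charFun ρ (2 * Real.pi * ξ)) :=
    (Real.fourierIntegral_convergent_iff z).2 hi
  have := VectorFourier.integral_fourierIntegral_smul_eq_flip (μ := volume) (ν := κ)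
      (e := Real.fourierChar) (L := -innerₗ ℝ) (g := (1 : ℝ → ℂ))
      Real.continuous_fourierChar (by
        simp only [LinearMap.neg_apply, innerₗ_apply_apply]
        fun_prop) hf (integrable_const 1)
  simp only [Pi.one_apply, smul_eq_mul, mul_one] at this
  calc _ = ∫ ξ : ℝ, (Real.fourierChar (-(inner ℝ ξ z)) • charFun ρ (2 * Real.pi * ξ)) *
        charFun κ (2 * Real.pi * ξ) := by
        rw [Real.fourier_eq]
        refine integral_congr_ae (Eventually.of_forall fun ξ => ?_)
        simp only [h]
        rw [smul_mul_assoc]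
    _ = _ := by
        refine Eq.trans ?_ (this.symm.trans ?_)
        · refine integral_congr_ae (Eventually.of_forall fun ξ => ?_)
          simp only
          congr 1
          rw [charFun_two_pi_eq_fourierIntegral]
          simp only [VectorFourier.fourierIntegral, LinearMap.flip_apply, LinearMap.neg_apply,
            innerₗ_apply_apply, inner_neg_right]
          simp only [real_inner_comm]
        · refine integral_congr_ae (Eventually.of_forall fun y => ?_)
          simp only
          rw [Real.fourier_eq]
          refine integral_congr_ae (Eventually.of_forall fun ξ => ?_)
          simp only [LinearMap.neg_apply, innerₗ_apply_apply, neg_neg]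
          rw [smul_smul, ← AddChar.map_add_eq_mul, inner_sub_right]
          congr 2
          ring

lemma inversionDensity_map_mul (μ : Measure ℝ) {a : ℝ} (ha : 0 < a) (x : ℝ) :
    inversionDensity (μ.map (a * ·)) x = a⁻¹ * inversionDensity μ (x / a) := by
  unfold inversionDensity
  rw [← Complex.re_ofReal_mul]
  congr 1
  rw [Real.fourier_eq, Real.fourier_eq]
  have := Measure.integral_comp_mul_left (fun ξ : ℝ => Real.fourierChar (-(inner ℝ ξ (x / a))) •
      charFun μ (2 * Real.pi * ξ)) a
  rw [abs_of_pos (inv_pos.mpr ha)] at this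
  rw [← Complex.real_smul, ← this]
  refine integral_congr_ae (Eventually.of_forall fun ξ => ?_)
  simp only [charFun_map_mul]
  congr 2
  · simp; field_simp
  · ring

/-! ### Stable laws and the positivity of their densities -/

lemma integrable_of_even_of_integrableOn_Ioi {f : ℝ → ℝ} (heven : ∀ x, f (-x) = f x)
    (hf : IntegrableOn f (Ioi 0)) : Integrable f := by
  have hg : Integrable ((Ioi (0 : ℝ)).indicator f) :=
    (integrable_indicator_iff measurableSet_Ioi).mpr hf
  refine (hg.add hg.comp_neg).congr ?_
  filter_upwards [Measure.ae_ne volume 0] with x hx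
  rcases lt_or_gt_of_ne hx with h | h
  · simp [indicator, h, h.le, heven]
  · simp [indicator, h, h.le]

lemma integrable_pow_abs_mul_exp_neg_rpow {α F : ℝ} (hα : 0 < α) (hF : 0 < F) (n : ℕ) :
    Integrable (fun t : ℝ => |t| ^ n * Real.exp (-(F * |t| ^ α))) := by
  refine integrable_of_even_of_integrableOn_Ioi (fun x => by simp) ?_
  refine (integrableOn_rpow_mul_exp_neg_mul_rpow (s := n)
    (by linarith [Nat.cast_nonneg (α := ℝ) n]) hα hF).congr_fun (fun x hx => ?_) measurableSet_Ioi
  rw [mem_Ioi] at hx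
  simp [abs_of_pos hx]

lemma sign_mul_of_pos {c t : ℝ} (hc : 0 < c) : Real.sign (c * t) = Real.sign t := by
  rcases lt_trichotomy t 0 with h | h | h
  · rw [Real.sign_of_neg h, Real.sign_of_neg (mul_neg_of_pos_of_neg hc h)]
  · simp [h]
  · rw [Real.sign_of_pos h, Real.sign_of_pos (mul_pos hc h)]

namespace IsStableLaw

variable {α β F : ℝ} {μ : Measure ℝ}

lemma isProbabilityMeasure (hμ : IsStableLaw α β F μ) : IsProbabilityMeasure μ := hμ.1

lemma norm_charFun (hμ : IsStableLaw α β F μ) (t : ℝ) :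
    ‖charFun μ t‖ = Real.exp (-(F * |t| ^ α)) := by
  rw [hμ.2, Complex.norm_exp, ← Complex.ofReal_neg, Complex.re_ofReal_mul,
    Complex.sub_re, Complex.re_mul_ofReal, Complex.I_re]
  simp

lemma integrable_pow_mul_charFun (hμ : IsStableLaw α β F μ) (hα : 0 < α) (hF : 0 < F) (n : ℕ) :
    Integrable (fun t : ℝ => |t| ^ n * ‖charFun μ t‖) := by
  simp only [hμ.norm_charFun]
  exact integrable_pow_abs_mul_exp_neg_rpow hα hF n

lemma integrable_charFun (hμ : IsStableLaw α β F μ) (hα : 0 < α) (hF : 0 < F) :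
    Integrable (charFun μ) := by
  have := hμ.isProbabilityMeasure
  have h := hμ.integrable_pow_mul_charFun hα hF 0
  simp only [pow_zero, one_mul] at h
  exact (integrable_norm_iff measurable_charFun.aestronglyMeasurable).mp h

lemma contDiff_inversionDensity (hμ : IsStableLaw α β F μ) (hα : 0 < α) (hF : 0 < F) :
    ContDiff ℝ (⊤ : ℕ∞) (inversionDensity μ) := by
  refine Complex.reCLM.contDiff.comp (Real.contDiff_fourier fun n _ => ?_)
  have h := (hμ.integrable_pow_mul_charFun hα hF n).comp_mul_left' (R := 2 * Real.pi)
    (by positivity)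
  refine (h.const_mul ((2 * Real.pi) ^ n)⁻¹).congr (Eventually.of_forall fun t => ?_)
  simp only [Real.norm_eq_abs, abs_mul, abs_of_pos Real.pi_pos, abs_two, mul_pow]
  field_simp

/-- The stable laws with the same `α` and `β` differ by a scaling only. -/
lemma eq_map_mul {ν : Measure ℝ} (hμ : IsStableLaw α β F μ) (hν : IsStableLaw α β 1 ν)
    (hα : 0 < α) (hF : 0 < F) : μ = ν.map (F ^ (1 / α) * ·) := by
  have := hμ.isProbabilityMeasure
  have := hν.isProbabilityMeasure
  have hs : 0 < F ^ (1 / α) := Real.rpow_pos_of_pos hF _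
  refine Measure.ext_of_charFun (funext fun t => ?_)
  rw [charFun_map_mul, hμ.2, hν.2, abs_mul, abs_of_pos hs,
    Real.mul_rpow hs.le (abs_nonneg t), ← Real.rpow_mul hF.le, one_div_mul_cancel hα.ne',
    Real.rpow_one, one_mul]
  rw [sign_mul_of_pos hs]

/-- Strict stability on the level of characteristic functions. -/
lemma charFun_eq_charFun_mul_charFun (hμ : IsStableLaw α β F μ) {a b : ℝ}
    (ha : 0 < a) (hb : 0 < b) (hab : a ^ α + b ^ α = 1) (t : ℝ) :
    charFun μ t = charFun (μ.map (a * ·)) t * charFun (μ.map (b * ·)) t := by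
  rw [charFun_map_mul, charFun_map_mul, hμ.2, hμ.2, hμ.2, ← Complex.exp_add, sign_mul_of_pos ha,
    sign_mul_of_pos hb, abs_mul, abs_mul, abs_of_pos ha, abs_of_pos hb,
    Real.mul_rpow ha.le (abs_nonneg t), Real.mul_rpow hb.le (abs_nonneg t)]
  congr 1
  have h : F * |t| ^ α = F * (a ^ α * |t| ^ α) + F * (b ^ α * |t| ^ α) := by
    rw [← mul_add, ← add_mul, hab, one_mul]
  rw [h, Complex.ofReal_add]
  ring

lemma inversionDensity_eq_integral (hμ : IsStableLaw α β F μ) (hα : 0 < α) (hF : 0 < F) {a b : ℝ}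
    (ha : 0 < a) (hb : 0 < b) (hab : a ^ α + b ^ α = 1) (z : ℝ) :
    inversionDensity μ z = a⁻¹ * ∫ y, inversionDensity μ ((z - b * y) / a) ∂μ := by
  have := hμ.isProbabilityMeasure
  have := Measure.isProbabilityMeasure_map (μ := μ) (f := (b * ·)) (by fun_prop)
  have hi : Integrable (charFun (μ.map (a * ·))) := by
    have h := (hμ.integrable_charFun hα hF).comp_mul_left' ha.ne'
    exact h.congr (Eventually.of_forall fun t => (charFun_map_mul a t).symm)
  have hcont : Continuous fun y => inversionDensity (μ.map (a * ·)) (z - y) :=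
    (continuous_inversionDensity hi).comp (by fun_prop)
  rw [inversionDensity_eq_integral_of_charFun_eq_mul hi
    (hμ.charFun_eq_charFun_mul_charFun ha hb hab), integral_map (by fun_prop)
    hcont.aestronglyMeasurable, ← integral_const_mul]
  simp only [inversionDensity_map_mul μ ha]

lemma measure_pos_of_inversionDensity_pos (hμ : IsStableLaw α β F μ) (hα : 0 < α) (hF : 0 < F)
    {x : ℝ} (hx : 0 < inversionDensity μ x) {s : Set ℝ} (hs : s ∈ 𝓝 x) : 0 < μ s := by
  have := hμ.isProbabilityMeasure
  have hi := hμ.integrable_charFun hα hF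
  have hc := continuous_inversionDensity hi
  have ht : s ∩ {y | 0 < inversionDensity μ y} ∈ 𝓝 x :=
    inter_mem hs (hc.continuousAt.eventually (lt_mem_nhds hx))
  obtain ⟨r, hr, hball⟩ := Metric.mem_nhds_iff.mp ht
  refine lt_of_lt_of_le ?_ (measure_mono (hball.trans inter_subset_left))
  rw [eq_withDensity_inversionDensity hi, withDensity_apply _ measurableSet_ball,
    setLIntegral_pos_iff (by fun_prop)]
  refine (Metric.measure_ball_pos volume x hr).trans_le (measure_mono fun y hy => ⟨?_, hy⟩)
  have := (hball hy).2
  simpa using this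

lemma measure_inversionDensity_le_zero (hμ : IsStableLaw α β F μ) (hα : 0 < α) (hF : 0 < F) :
    μ {x | inversionDensity μ x ≤ 0} = 0 := by
  have := hμ.isProbabilityMeasure
  have hi := hμ.integrable_charFun hα hF
  have hc := continuous_inversionDensity hi
  have hm : MeasurableSet {x | inversionDensity μ x ≤ 0} :=
    measurableSet_le hc.measurable measurable_const
  refine (congrArg (fun κ : Measure ℝ => κ {x | inversionDensity μ x ≤ 0})
    (eq_withDensity_inversionDensity hi)).trans ?_
  rw [withDensity_apply _ hm]
  rw [setLIntegral_congr_fun (g := fun _ => 0) hm fun x hx => ENNReal.ofReal_of_nonpos hx]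
  simp

/-- Stability makes the positivity set of the density closed under the combinations
`a x + b y` with `a ^ α + b ^ α = 1`. -/
lemma inversionDensity_pos_of_pos (hμ : IsStableLaw α β F μ) (hα : 0 < α) (hF : 0 < F) {a b : ℝ}
    (ha : 0 < a) (hb : 0 < b) (hab : a ^ α + b ^ α = 1) {x y : ℝ}
    (hx : 0 < inversionDensity μ x) (hy : 0 < inversionDensity μ y) :
    0 < inversionDensity μ (a * x + b * y) := by
  have := hμ.isProbabilityMeasure
  have hi := hμ.integrable_charFun hα hF
  have hc := continuous_inversionDensity hi
  rw [hμ.inversionDensity_eq_integral hα hF ha hb hab]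
  refine mul_pos (inv_pos.mpr ha) ?_
  have hcont : Continuous fun v => inversionDensity μ ((a * x + b * y - b * v) / a) := by fun_prop
  rw [integral_pos_iff_support_of_nonneg (fun v => inversionDensity_nonneg hi _)]
  · refine hμ.measure_pos_of_inversionDensity_pos hα hF hy ?_
    have h0 : inversionDensity μ ((a * x + b * y - b * y) / a) ≠ 0 := by
      rw [add_sub_cancel_right, mul_div_cancel_left₀ _ ha.ne']
      exact hx.ne'
    exact hcont.continuousAt.eventually_ne h0
  · exact Integrable.of_bound hcont.aestronglyMeasurable _
      (Eventually.of_forall fun v => abs_inversionDensity_le μ _)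

/-- Every point of the positivity set of the density is a combination `a x + b y` of points of
it, for given `a ^ α + b ^ α = 1`. -/
lemma exists_inversionDensity_pos_add (hμ : IsStableLaw α β F μ) (hα : 0 < α) (hF : 0 < F)
    {a b : ℝ} (ha : 0 < a) (hb : 0 < b) (hab : a ^ α + b ^ α = 1) {z : ℝ}
    (hz : 0 < inversionDensity μ z) :
    ∃ x y, 0 < inversionDensity μ x ∧ 0 < inversionDensity μ y ∧ z = a * x + b * y := by
  by_contra! h
  have := hμ.isProbabilityMeasure
  have hi := hμ.integrable_charFun hα hF
  rw [hμ.inversionDensity_eq_integral hα hF ha hb hab] at hz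
  have h0 : ∫ y, inversionDensity μ ((z - b * y) / a) ∂μ = 0 := by
    refine integral_eq_zero_of_ae ?_
    have hae : ∀ᵐ y ∂μ, 0 < inversionDensity μ y := by
      rw [ae_iff]
      simpa only [not_lt] using hμ.measure_inversionDensity_le_zero hα hF
    filter_upwards [hae] with y hy
    by_contra hne
    exact h ((z - b * y) / a) y
      (lt_of_le_of_ne (inversionDensity_nonneg hi _) (Ne.symm hne)) hy
      (by rw [mul_div_cancel₀ _ ha.ne']; ring)
  simp [h0] at hz

lemma exists_inversionDensity_pos (hμ : IsStableLaw α β F μ) (hα : 0 < α) (hF : 0 < F) :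
    ∃ x, 0 < inversionDensity μ x := by
  by_contra! h
  have := hμ.isProbabilityMeasure
  have h0 := hμ.measure_inversionDensity_le_zero hα hF
  rw [eq_univ_of_forall (s := {x | inversionDensity μ x ≤ 0}) h] at h0
  simp at h0

end IsStableLaw

section StableSets

variable {α : ℝ} {U : Set ℝ}

lemma exists_rpow_add_rpow_eq_one_and_add_eq (hα : 0 < α) {t : ℝ}
    (ht : t ∈ uIcc (2 ^ (1 - 1 / α)) 1) (ht1 : t ≠ 1) :
    ∃ a b : ℝ, 0 < a ∧ 0 < b ∧ a ^ α + b ^ α = 1 ∧ a + b = t := by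
  have hp : 0 < 1 / α := by positivity
  let s : ℝ → ℝ := fun θ => θ ^ (1 / α) + (1 - θ) ^ (1 / α)
  have hs : Continuous s := by
    refine (Real.continuous_rpow_const hp.le).add
      ((Real.continuous_rpow_const hp.le).comp (by fun_prop))
  have hs0 : s 0 = 1 := by simp [s, hα.ne']
  have hs2 : s (1 / 2) = 2 ^ (1 - 1 / α) := by
    simp only [s]
    rw [Real.rpow_sub two_pos, Real.rpow_one, show (1 : ℝ) - 1 / 2 = 1 / 2 by norm_num,
      Real.div_rpow zero_le_one zero_le_two, Real.one_rpow]
    ring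
  obtain ⟨θ, hθ, hst⟩ := intermediate_value_uIcc (a := 0) (b := 1 / 2) hs.continuousOn
    (by rw [hs0, hs2, uIcc_comm]; exact ht)
  rw [uIcc_of_le (by norm_num)] at hθ
  have hθ0 : θ ≠ 0 := by
    rintro rfl
    exact ht1 (by rw [← hst, hs0])
  have hθ1 : 0 < θ := lt_of_le_of_ne hθ.1 hθ0.symm
  have hθ2 : 0 < 1 - θ := by linarith [hθ.2]
  refine ⟨θ ^ (1 / α), (1 - θ) ^ (1 / α), Real.rpow_pos_of_pos hθ1 _, Real.rpow_pos_of_pos hθ2 _,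
    ?_, hst⟩
  rw [← Real.rpow_mul hθ1.le, ← Real.rpow_mul hθ2.le, one_div_mul_cancel hα.ne']
  simp

lemma two_rpow_neg_inv_rpow_add (hα : 0 < α) :
    ((2 : ℝ) ^ (-(1 / α))) ^ α + ((2 : ℝ) ^ (-(1 / α))) ^ α = 1 := by
  rw [← Real.rpow_mul zero_le_two, neg_mul, one_div_mul_cancel hα.ne', Real.rpow_neg_one]
  norm_num

/-- An open set of reals that is closed under, and exhausted by, the combinations `a x + b y` with
`a ^ α + b ^ α = 1` contains the positive half-line as soon as it meets it. Closure under such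
combinations gives closure under the scalings `a + b`, which are contractions for `α < 1` and
dilations for `α > 1`. The doubling `a = b` forces the supremum to be infinite in the first case
and the infimum to vanish in the second. -/
lemma Ioi_subset_of_rpow_combinations (hα : 0 < α) (hα1 : α ≠ 1) (hU : IsOpen U)
    (hcomb : ∀ a b : ℝ, 0 < a → 0 < b → a ^ α + b ^ α = 1 → ∀ x ∈ U, ∀ y ∈ U, a * x + b * y ∈ U)
    (hsplit : ∀ a b : ℝ, 0 < a → 0 < b → a ^ α + b ^ α = 1 → ∀ z ∈ U, ∃ x ∈ U, ∃ y ∈ U,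
      z = a * x + b * y)
    {x₀ : ℝ} (hx₀ : x₀ ∈ U) (hx₀pos : 0 < x₀) {z : ℝ} (hz : 0 < z) : z ∈ U := by
  set c : ℝ := 2 ^ (-(1 / α)) with hc
  have hcpos : 0 < c := Real.rpow_pos_of_pos two_pos _
  set κ : ℝ := 2 ^ (1 - 1 / α) with hκ
  have hκpos : 0 < κ := Real.rpow_pos_of_pos two_pos _
  have hκc : κ = c + c := by
    rw [hκ, hc, sub_eq_add_neg, Real.rpow_add two_pos, Real.rpow_one]; ring
  have hcc : c ^ α + c ^ α = 1 := two_rpow_neg_inv_rpow_add hα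
  have hscale : ∀ t ∈ uIcc κ 1, ∀ x ∈ U, t * x ∈ U := by
    intro t ht x hx
    by_cases ht1 : t = 1
    · simpa [ht1] using hx
    obtain ⟨a, b, ha, hb, hab, rfl⟩ := exists_rpow_add_rpow_eq_one_and_add_eq hα ht ht1
    rw [add_mul]
    exact hcomb a b ha hb hab x hx x hx
  rcases lt_or_gt_of_ne hα1 with h | h
  · have hκ1 : κ < 1 := by
      refine Real.rpow_lt_one_of_one_lt_of_neg one_lt_two ?_
      rw [sub_neg, lt_div_iff₀ hα]; linarith
    have hiter : ∀ n : ℕ, ∀ t ∈ Icc (κ ^ n) 1, ∀ x ∈ U, t * x ∈ U := by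
      intro n
      induction n with
      | zero =>
        intro t ht x hx
        rw [pow_zero] at ht
        rw [le_antisymm ht.2 ht.1, one_mul]; exact hx
      | succ n ih =>
        intro t ht x hx
        rcases le_or_gt κ t with hκt | hκt
        · exact hscale t (by rw [uIcc_of_le hκ1.le]; exact ⟨hκt, ht.2⟩) x hx
        · have h1 := ih (t / κ)
            ⟨by rw [le_div_iff₀ hκpos, ← pow_succ]; exact ht.1, by
              rw [div_le_one hκpos]; exact hκt.le⟩ x hx
          have h2 := hscale κ left_mem_uIcc _ h1
          rwa [← mul_assoc, mul_div_cancel₀ _ hκpos.ne'] at h2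
    have hunb : ¬ BddAbove U := by
      intro hbdd
      have hM : 0 < sSup U := hx₀pos.trans_le (le_csSup hbdd hx₀)
      have : sSup U ≤ κ * sSup U := by
        refine csSup_le ⟨x₀, hx₀⟩ fun w hw => ?_
        obtain ⟨x, hx, y, hy, rfl⟩ := hsplit c c hcpos hcpos hcc w hw
        have h1 := le_csSup hbdd hx
        have h2 := le_csSup hbdd hy
        rw [hκc]
        nlinarith
      nlinarith
    obtain ⟨x, hx, hzx⟩ := not_bddAbove_iff.mp hunb z
    have hxpos : 0 < x := hz.trans hzx
    obtain ⟨n, hn⟩ := exists_pow_lt_of_lt_one (div_pos hz hxpos) hκ1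
    have := hiter n (z / x) ⟨hn.le, by rw [div_le_one hxpos]; exact hzx.le⟩ x hx
    rwa [div_mul_cancel₀ _ hxpos.ne'] at this
  · have hκ1 : 1 < κ := by
      refine Real.one_lt_rpow one_lt_two ?_
      rw [sub_pos, div_lt_one hα]; exact h
    have hiter : ∀ n : ℕ, ∀ t ∈ Icc 1 (κ ^ n), ∀ x ∈ U, t * x ∈ U := by
      intro n
      induction n with
      | zero =>
        intro t ht x hx
        rw [pow_zero] at ht
        rw [le_antisymm ht.2 ht.1, one_mul]; exact hx
      | succ n ih =>
        intro t ht x hx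
        rcases le_or_gt t κ with hκt | hκt
        · exact hscale t (by rw [uIcc_of_ge hκ1.le]; exact ⟨ht.1, hκt⟩) x hx
        · have h1 := ih (t / κ)
            ⟨by rw [one_le_div hκpos]; exact hκt.le, by
              rw [div_le_iff₀ hκpos, ← pow_succ]; exact ht.2⟩ x hx
          have h2 := hscale κ left_mem_uIcc _ h1
          rwa [← mul_assoc, mul_div_cancel₀ _ hκpos.ne'] at h2
    have hsmall : ∃ x ∈ U, 0 < x ∧ x < z := by
      by_cases h0 : (0 : ℝ) ∈ U
      · obtain ⟨ε, hε, hball⟩ := Metric.isOpen_iff.mp hU 0 h0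
        refine ⟨min (ε / 2) (z / 2), hball ?_, by positivity, ?_⟩
        · rw [mem_ball_zero_iff, Real.norm_of_nonneg (by positivity)]
          exact (min_le_left _ _).trans_lt (by linarith)
        · exact (min_le_right _ _).trans_lt (by linarith)
      · have hposU : ∀ y ∈ U, 0 < y := by
          intro y hy
          by_contra! hy0
          have hyneg : y < 0 := lt_of_le_of_ne hy0 fun h => h0 (h ▸ hy)
          -- a positive and a negative point admit a vanishing combination
          set r : ℝ := -y / x₀ with hr
          have hrpos : 0 < r := div_pos (by linarith) hx₀pos
          have hDpos : 0 < r ^ α + 1 := by positivity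
          set b : ℝ := (1 / (r ^ α + 1)) ^ (1 / α) with hb
          have hbpos : 0 < b := Real.rpow_pos_of_pos (by positivity) _
          have hbα : b ^ α = 1 / (r ^ α + 1) := by
            rw [hb, ← Real.rpow_mul (by positivity), one_div_mul_cancel hα.ne', Real.rpow_one]
          have hab : (r * b) ^ α + b ^ α = 1 := by
            rw [Real.mul_rpow hrpos.le hbpos.le, hbα]
            field_simp
          have := hcomb (r * b) b (mul_pos hrpos hbpos) hbpos hab x₀ hx₀ y hy
          refine h0 ?_
          convert this using 1
          rw [hr]
          field_simp
          ring
        have hbdd : BddBelow U := ⟨0, fun y hy => (hposU y hy).le⟩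
        have hm : 0 ≤ sInf U := le_csInf ⟨x₀, hx₀⟩ fun y hy => (hposU y hy).le
        have hle : κ * sInf U ≤ sInf U := by
          refine le_csInf ⟨x₀, hx₀⟩ fun w hw => ?_
          obtain ⟨x, hx, y, hy, rfl⟩ := hsplit c c hcpos hcpos hcc w hw
          have h1 := csInf_le hbdd hx
          have h2 := csInf_le hbdd hy
          rw [hκc]
          nlinarith
        have hm0 : sInf U < z := by nlinarith
        obtain ⟨x, hx, hxz⟩ := exists_lt_of_csInf_lt ⟨x₀, hx₀⟩ hm0
        exact ⟨x, hx, hposU x hx, hxz⟩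
    obtain ⟨x, hx, hxpos, hxz⟩ := hsmall
    obtain ⟨n, hn⟩ := pow_unbounded_of_one_lt (z / x) hκ1
    have := hiter n (z / x) ⟨by rw [one_le_div hxpos]; exact hxz.le, hn.le⟩ x hx
    rwa [div_mul_cancel₀ _ hxpos.ne'] at this

end StableSets

/-- The density of `|X|` is positive on the positive half-line, for `X` stable with `α ≠ 1`. -/
lemma IsStableLaw.inversionDensity_add_neg_pos {α β F : ℝ} {μ : Measure ℝ}
    (hμ : IsStableLaw α β F μ) (hα : 0 < α) (hα1 : α ≠ 1) (hF : 0 < F) {z : ℝ} (hz : 0 < z) :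
    0 < inversionDensity μ z + inversionDensity μ (-z) := by
  have := hμ.isProbabilityMeasure
  have hi := hμ.integrable_charFun hα hF
  have hc := continuous_inversionDensity hi
  have hopen : IsOpen {x | 0 < inversionDensity μ x} := isOpen_lt continuous_const hc
  have key : ∀ s : ℝ, s * s = 1 → (∃ x, 0 < x ∧ 0 < inversionDensity μ (s * x)) →
      0 < inversionDensity μ (s * z) := by
    rintro s hs ⟨x₀, hx₀, hpos⟩
    refine Ioi_subset_of_rpow_combinations (U := {x | 0 < inversionDensity μ (s * x)}) hα hα1
      (isOpen_lt continuous_const (by fun_prop)) ?_ ?_ hpos hx₀ hz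
    · intro a b ha hb hab x hx y hy
      have := hμ.inversionDensity_pos_of_pos hα hF ha hb hab hx hy
      rw [mem_ofPred_eq]
      convert this using 2
      ring
    · intro a b ha hb hab w hw
      obtain ⟨x, y, hx, hy, h⟩ := hμ.exists_inversionDensity_pos_add hα hF ha hb hab hw
      refine ⟨s * x, ?_, s * y, ?_, ?_⟩
      · rw [mem_ofPred_eq, ← mul_assoc, hs, one_mul]; exact hx
      · rw [mem_ofPred_eq, ← mul_assoc, hs, one_mul]; exact hy
      · linear_combination s * h - w * hs
  obtain ⟨x, hx⟩ := hμ.exists_inversionDensity_pos hα hF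
  obtain ⟨r, hr, hball⟩ := Metric.isOpen_iff.mp hopen x hx
  have hx' : ∃ y, y ≠ 0 ∧ 0 < inversionDensity μ y := by
    by_cases hx0 : x = 0
    · exact ⟨r / 2, by positivity, hball (by
        rw [hx0, mem_ball_zero_iff, Real.norm_of_nonneg (by positivity)]; linarith)⟩
    · exact ⟨x, hx0, hx⟩
  obtain ⟨y, hy0, hy⟩ := hx'
  have hn1 := inversionDensity_nonneg hi z
  have hn2 := inversionDensity_nonneg hi (-z)
  rcases lt_or_gt_of_ne hy0 with h | h
  · have := key (-1) (by norm_num) ⟨-y, by linarith, by simpa using hy⟩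
    rw [neg_one_mul] at this
    linarith
  · have := key 1 (by norm_num) ⟨y, h, by simpa using hy⟩
    rw [one_mul] at this
    linarith

/-! ### The distribution function and the quantile function of the absolute value -/

lemma norm_one_sub_exp_le {w : ℂ} (hw : w.re ≤ 0) : ‖1 - Complex.exp w‖ ≤ 2 * ‖w‖ := by
  rcases le_or_gt ‖w‖ 1 with h | h
  · rw [norm_sub_rev]
    exact Complex.norm_exp_sub_one_le h
  · have h1 : ‖Complex.exp w‖ ≤ 1 := by
      rw [Complex.norm_exp]; exact Real.exp_le_one_iff.mpr hw
    calc ‖1 - Complex.exp w‖ ≤ ‖(1 : ℂ)‖ + ‖Complex.exp w‖ := norm_sub_le _ _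
      _ ≤ 2 * ‖w‖ := by rw [norm_one]; linarith

namespace IsStableLaw

variable {α β F : ℝ} {μ : Measure ℝ}

lemma absCDF_eq_intervalIntegral (hμ : IsStableLaw α β F μ) (hα : 0 < α) (hF : 0 < F) {z : ℝ}
    (hz : 0 ≤ z) : absCDF μ z = ∫ x in (-z)..z, inversionDensity μ x := by
  have := hμ.isProbabilityMeasure
  have hi := hμ.integrable_charFun hα hF
  have hc := continuous_inversionDensity hi
  have hset : {x : ℝ | |x| ≤ z} = Icc (-z) z := by ext x; simp [abs_le]
  rw [absCDF, hset, intervalIntegral.integral_of_le (by linarith), ← integral_Icc_eq_integral_Ioc,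
    integral_eq_lintegral_of_nonneg_ae (Eventually.of_forall fun x => inversionDensity_nonneg hi x)
      hc.aestronglyMeasurable, Measure.real]
  congr 1
  refine (congrArg (fun κ : Measure ℝ => κ (Icc (-z) z))
    (eq_withDensity_inversionDensity hi)).trans ?_
  rw [withDensity_apply _ measurableSet_Icc]

lemma absCDF_of_nonpos (hμ : IsStableLaw α β F μ) (hα : 0 < α) (hF : 0 < F) {z : ℝ}
    (hz : z ≤ 0) : absCDF μ z = 0 := by
  rcases hz.lt_or_eq with h | rfl
  · have : {x : ℝ | |x| ≤ z} = ∅ := by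
      ext x
      simp only [mem_ofPred_eq, mem_empty_iff_false, iff_false, not_le]
      exact h.trans_le (abs_nonneg x)
    rw [absCDF, this, measureReal_empty]
  · rw [hμ.absCDF_eq_intervalIntegral hα hF le_rfl]
    simp

lemma absCDF_eq_sub (hμ : IsStableLaw α β F μ) (hα : 0 < α) (hF : 0 < F) {z : ℝ}
    (hz : 0 ≤ z) : absCDF μ z =
      (∫ x in (0 : ℝ)..z, inversionDensity μ x) - ∫ x in (0 : ℝ)..(-z), inversionDensity μ x := by
  have hc := continuous_inversionDensity (hμ.integrable_charFun hα hF)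
  rw [hμ.absCDF_eq_intervalIntegral hα hF hz, intervalIntegral.integral_interval_sub_left
    (hc.intervalIntegrable _ _) (hc.intervalIntegrable _ _)]

lemma contDiff_primitive (hμ : IsStableLaw α β F μ) (hα : 0 < α) (hF : 0 < F) :
    ContDiff ℝ (⊤ : ℕ∞) (fun z => ∫ x in (0 : ℝ)..z, inversionDensity μ x) := by
  have hc := continuous_inversionDensity (hμ.integrable_charFun hα hF)
  rw [contDiff_infty_iff_deriv]
  refine ⟨fun z => (hc.integral_hasStrictDerivAt 0 z).hasDerivAt.differentiableAt, ?_⟩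
  have : deriv (fun z => ∫ x in (0 : ℝ)..z, inversionDensity μ x) = inversionDensity μ :=
    funext fun z => hc.deriv_integral _ 0 z
  rw [this]
  exact hμ.contDiff_inversionDensity hα hF

lemma contDiffAt_absCDF (hμ : IsStableLaw α β F μ) (hα : 0 < α) (hF : 0 < F) {z : ℝ}
    (hz : 0 < z) : ContDiffAt ℝ (⊤ : ℕ∞) (absCDF μ) z := by
  have hP := hμ.contDiff_primitive hα hF
  refine ((hP.sub (hP.comp contDiff_neg)).contDiffAt (x := z)).congr_of_eventuallyEq ?_
  filter_upwards [lt_mem_nhds hz] with y hy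
  exact hμ.absCDF_eq_sub hα hF hy.le

lemma hasDerivAt_absCDF (hμ : IsStableLaw α β F μ) (hα : 0 < α) (hF : 0 < F) {z : ℝ}
    (hz : 0 < z) :
    HasDerivAt (absCDF μ) (inversionDensity μ z + inversionDensity μ (-z)) z := by
  have hc := continuous_inversionDensity (hμ.integrable_charFun hα hF)
  have h1 := (hc.integral_hasStrictDerivAt 0 z).hasDerivAt
  have h2 := (hc.integral_hasStrictDerivAt 0 (-z)).hasDerivAt.comp z (hasDerivAt_neg z)
  have h3 := h1.sub h2
  rw [mul_neg_one, sub_neg_eq_add] at h3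
  refine h3.congr_of_eventuallyEq ?_
  filter_upwards [lt_mem_nhds hz] with y hy
  exact hμ.absCDF_eq_sub hα hF hy.le

lemma continuous_absCDF (hμ : IsStableLaw α β F μ) (hα : 0 < α) (hF : 0 < F) :
    Continuous (absCDF μ) := by
  have hP := (hμ.contDiff_primitive hα hF).continuous
  have : absCDF μ = fun z => (∫ x in (0 : ℝ)..(max z 0), inversionDensity μ x) -
      ∫ x in (0 : ℝ)..(-(max z 0)), inversionDensity μ x := by
    funext z
    rw [← hμ.absCDF_eq_sub hα hF (le_max_right z 0)]
    rcases le_total z 0 with h | h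
    · rw [max_eq_right h, hμ.absCDF_of_nonpos hα hF h, hμ.absCDF_of_nonpos hα hF le_rfl]
    · rw [max_eq_left h]
  rw [this]
  exact (hP.comp (g := fun z => ∫ x in (0 : ℝ)..z, inversionDensity μ x)
    (f := fun z : ℝ => max z 0) (by fun_prop)).sub
    (hP.comp (g := fun z => ∫ x in (0 : ℝ)..z, inversionDensity μ x)
    (f := fun z : ℝ => -(max z 0)) (by fun_prop))

lemma strictMonoOn_absCDF (hμ : IsStableLaw α β F μ) (hα : 0 < α) (hα1 : α ≠ 1) (hF : 0 < F) :
    StrictMonoOn (absCDF μ) (Ici 0) := by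
  refine strictMonoOn_of_deriv_pos (convex_Ici 0) (hμ.continuous_absCDF hα hF).continuousOn
    fun z hz => ?_
  rw [interior_Ici, mem_Ioi] at hz
  rw [(hμ.hasDerivAt_absCDF hα hF hz).deriv]
  exact hμ.inversionDensity_add_neg_pos hα hα1 hF hz

lemma absDensity_pos (hμ : IsStableLaw α β F μ) (hα : 0 < α) (hα1 : α ≠ 1) (hF : 0 < F) {z : ℝ}
    (hz : 0 < z) : 0 < absDensity μ z := by
  rw [absDensity, (hμ.hasDerivAt_absCDF hα hF hz).deriv]
  exact hμ.inversionDensity_add_neg_pos hα hα1 hF hz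

lemma absCDF_le_one (hμ : IsStableLaw α β F μ) (z : ℝ) : absCDF μ z ≤ 1 := by
  have := hμ.isProbabilityMeasure
  exact measureReal_le_one

lemma absCDF_lt_one (hμ : IsStableLaw α β F μ) (hα : 0 < α) (hα1 : α ≠ 1) (hF : 0 < F) (z : ℝ) :
    absCDF μ z < 1 := by
  rcases le_total z 0 with h | h
  · rw [hμ.absCDF_of_nonpos hα hF h]; exact zero_lt_one
  · have h1 : (0 : ℝ) ≤ z + 1 := by linarith
    exact (hμ.strictMonoOn_absCDF hα hα1 hF h h1 (by linarith)).trans_le (hμ.absCDF_le_one _)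

/-- The tail of a stable law of index `α` is at most of order `z ^ (-α)`, because its characteristic
function is `1 + O(|t| ^ α)` at the origin. -/
lemma exists_rpow_mul_one_sub_absCDF_le (hμ : IsStableLaw α β F μ) (hα : 0 < α) (hF : 0 < F) :
    ∃ C, 0 < C ∧ ∀ z, 0 < z → z ^ α * (1 - absCDF μ z) ≤ C := by
  have := hμ.isProbabilityMeasure
  set T : ℝ := |β| * |Real.tan (Real.pi * α / 2)| with hT
  have hTnn : 0 ≤ T := by positivity
  have hbound : ∀ t, ‖1 - charFun μ t‖ ≤ 2 * (F * (1 + T)) * |t| ^ α := by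
    intro t
    have hnn : 0 ≤ F * |t| ^ α := by positivity
    rw [hμ.2]
    refine (norm_one_sub_exp_le ?_).trans ?_
    · rw [← Complex.ofReal_neg, Complex.re_ofReal_mul,
        Complex.sub_re, Complex.re_mul_ofReal, Complex.I_re]
      simpa using hnn
    · rw [norm_mul, norm_neg, Complex.norm_real, Real.norm_of_nonneg hnn]
      have h1 : ‖1 - Complex.I * ((β * Real.sign t * Real.tan (Real.pi * α / 2) : ℝ) : ℂ)‖
          ≤ 1 + T := by
        refine (norm_sub_le _ _).trans ?_
        rw [norm_one, norm_mul, Complex.norm_I, one_mul, Complex.norm_real, Real.norm_eq_abs,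
          abs_mul, abs_mul, hT]
        have hs : |Real.sign t| ≤ 1 := by
          rcases Real.sign_apply_eq t with h | h | h <;> rw [h] <;> norm_num
        have : |β| * |Real.sign t| ≤ |β| * 1 := by gcongr
        have h2 : |β| * |Real.sign t| * |Real.tan (Real.pi * α / 2)|
            ≤ |β| * 1 * |Real.tan (Real.pi * α / 2)| := by gcongr
        linarith
      have := mul_le_mul_of_nonneg_left h1 hnn
      nlinarith
  refine ⟨2 * (2 * (F * (1 + T)) * 2 ^ α), by positivity, fun z hz => ?_⟩
  have hcompl : 1 - absCDF μ z = μ.real {x | z < |x|} := by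
    rw [absCDF, ← probReal_compl_eq_one_sub (measurableSet_le (by fun_prop) (by fun_prop))]
    congr 1
    ext x
    simp
  have hzinv : 0 < z⁻¹ := inv_pos.mpr hz
  have hint : ‖∫ t in (-2 * z⁻¹)..(2 * z⁻¹), 1 - charFun μ t‖
      ≤ 2 * (F * (1 + T)) * (2 * z⁻¹) ^ α * |2 * z⁻¹ - -2 * z⁻¹| := by
    refine intervalIntegral.norm_integral_le_of_norm_le_const fun t ht => (hbound t).trans ?_
    rw [uIoc_of_le (by linarith)] at ht
    have : |t| ≤ 2 * z⁻¹ := abs_le.mpr ⟨by linarith [ht.1], ht.2⟩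
    gcongr
  rw [hcompl]
  have hmain := measureReal_abs_gt_le_integral_charFun (μ := μ) hz
  have hzα : 0 < z ^ α := Real.rpow_pos_of_pos hz α
  have habs : |2 * z⁻¹ - -2 * z⁻¹| = 4 * z⁻¹ := by
    rw [show 2 * z⁻¹ - -2 * z⁻¹ = 4 * z⁻¹ by ring, abs_of_pos (by positivity)]
  rw [habs, Real.mul_rpow zero_le_two hzinv.le, Real.inv_rpow hz.le] at hint
  calc z ^ α * μ.real {x | z < |x|}
      ≤ z ^ α * (2⁻¹ * z * (2 * (F * (1 + T)) * (2 ^ α * (z ^ α)⁻¹) * (4 * z⁻¹))) := by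
        gcongr
        exact hmain.trans (by gcongr)
    _ = 2 * (2 * (F * (1 + T)) * 2 ^ α) := by
        field_simp
        ring

lemma exists_absCDF_eq (hμ : IsStableLaw α β F μ) (hα : 0 < α) (hF : 0 < F) {u : ℝ}
    (hu : u ∈ Ioo 0 1) : ∃ z, 0 < z ∧ absCDF μ z = u := by
  obtain ⟨C, hC, htail⟩ := hμ.exists_rpow_mul_one_sub_absCDF_le hα hF
  have hpos : 0 < 1 - u := by linarith [hu.2]
  set b : ℝ := (C / (1 - u)) ^ (1 / α) with hb
  have hbpos : 0 < b := Real.rpow_pos_of_pos (by positivity) _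
  have hbα : b ^ α = C / (1 - u) := by
    rw [hb, ← Real.rpow_mul (by positivity), one_div_mul_cancel hα.ne', Real.rpow_one]
  have hub : u ≤ absCDF μ b := by
    have := htail b hbpos
    rw [hbα, div_mul_eq_mul_div, div_le_iff₀ hpos] at this
    have := le_of_mul_le_mul_left this hC
    linarith
  obtain ⟨z, hz, hzu⟩ := intermediate_value_Icc hbpos.le
    (hμ.continuous_absCDF hα hF).continuousOn
    ⟨by rw [hμ.absCDF_of_nonpos hα hF le_rfl]; exact hu.1.le, hub⟩
  refine ⟨z, lt_of_le_of_ne hz.1 ?_, hzu⟩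
  rintro rfl
  rw [hμ.absCDF_of_nonpos hα hF le_rfl] at hzu
  exact hu.1.ne hzu

lemma absQuantile_absCDF (hμ : IsStableLaw α β F μ) (hα : 0 < α) (hα1 : α ≠ 1) (hF : 0 < F)
    {z : ℝ} (hz : 0 < z) : absQuantile μ (absCDF μ z) = z := by
  have hmono := hμ.strictMonoOn_absCDF hα hα1 hF
  have : {w : ℝ | absCDF μ z ≤ absCDF μ w} = Ici z := by
    ext w
    simp only [mem_ofPred_eq, mem_Ici]
    rcases le_or_gt w 0 with hw | hw
    · rw [hμ.absCDF_of_nonpos hα hF hw]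
      have h0 : 0 < absCDF μ z := by
        rw [← hμ.absCDF_of_nonpos hα hF (le_refl 0)]
        exact hmono self_mem_Ici hz.le hz
      constructor
      · intro h; linarith
      · intro h; linarith
    · exact hmono.le_iff_le hz.le hw.le
  rw [absQuantile, this, csInf_Ici]

lemma absQuantile_pos (hμ : IsStableLaw α β F μ) (hα : 0 < α) (hα1 : α ≠ 1) (hF : 0 < F)
    {u : ℝ} (hu : u ∈ Ioo 0 1) : 0 < absQuantile μ u := by
  obtain ⟨z, hz, rfl⟩ := hμ.exists_absCDF_eq hα hF hu
  rwa [hμ.absQuantile_absCDF hα hα1 hF hz]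

lemma absCDF_absQuantile (hμ : IsStableLaw α β F μ) (hα : 0 < α) (hα1 : α ≠ 1) (hF : 0 < F)
    {u : ℝ} (hu : u ∈ Ioo 0 1) : absCDF μ (absQuantile μ u) = u := by
  obtain ⟨z, hz, rfl⟩ := hμ.exists_absCDF_eq hα hF hu
  rw [hμ.absQuantile_absCDF hα hα1 hF hz]

lemma absCDF_eq_iff (hμ : IsStableLaw α β F μ) (hα : 0 < α) (hα1 : α ≠ 1) (hF : 0 < F)
    {u : ℝ} (hu : u ∈ Ioo 0 1) (z : ℝ) : absCDF μ z = u ↔ z = absQuantile μ u := by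
  constructor
  · rintro rfl
    have hz : 0 < z := by
      by_contra! h
      exact hu.1.ne' (hμ.absCDF_of_nonpos hα hF h)
    exact (hμ.absQuantile_absCDF hα hα1 hF hz).symm
  · rintro rfl
    exact hμ.absCDF_absQuantile hα hα1 hF hu

lemma absQuantile_le_iff (hμ : IsStableLaw α β F μ) (hα : 0 < α) (hα1 : α ≠ 1) (hF : 0 < F)
    {u : ℝ} (hu : u ∈ Ioo 0 1) (z : ℝ) : absQuantile μ u ≤ z ↔ u ≤ absCDF μ z := by
  have hQ := hμ.absQuantile_pos hα hα1 hF hu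
  rcases le_or_gt z 0 with hz | hz
  · rw [hμ.absCDF_of_nonpos hα hF hz]
    exact ⟨fun h => by linarith, fun h => by linarith [hu.1]⟩
  · rw [← (hμ.strictMonoOn_absCDF hα hα1 hF).le_iff_le hQ.le hz.le,
      hμ.absCDF_absQuantile hα hα1 hF hu]

lemma contDiffAt_absQuantile (hμ : IsStableLaw α β F μ) (hα : 0 < α) (hα1 : α ≠ 1) (hF : 0 < F)
    {u : ℝ} (hu : u ∈ Ioo 0 1) :
    ContDiffAt ℝ (⊤ : ℕ∞) (absQuantile μ) u ∧
      HasDerivAt (absQuantile μ) (absDensity μ (absQuantile μ u))⁻¹ u := by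
  set z := absQuantile μ u with hz
  have hzpos : 0 < z := hμ.absQuantile_pos hα hα1 hF hu
  have hzu : absCDF μ z = u := hμ.absCDF_absQuantile hα hα1 hF hu
  have hd : HasDerivAt (absCDF μ) (absDensity μ z) z :=
    (hμ.hasDerivAt_absCDF hα hF hzpos).differentiableAt.hasDerivAt
  have hd0 : absDensity μ z ≠ 0 := (hμ.absDensity_pos hα hα1 hF hzpos).ne'
  have hc := hμ.contDiffAt_absCDF hα hF hzpos
  have htop : ((⊤ : ℕ∞) : WithTop ℕ∞) ≠ 0 := by simp
  have hfd := hd.hasFDerivAt_equiv hd0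
  have hloc := hc.to_localInverse hfd htop
  have hstrict := hc.hasStrictFDerivAt' hfd htop
  have hright : ∀ᶠ y in 𝓝 (absCDF μ z), absCDF μ (hc.localInverse hfd htop y) = y :=
    hstrict.eventually_right_inverse
  have hpos : ∀ᶠ y in 𝓝 (absCDF μ z), 0 < hc.localInverse hfd htop y := by
    refine hloc.continuousAt.eventually (lt_mem_nhds ?_)
    rw [hc.localInverse_apply_image hfd htop]
    exact hzpos
  have hsmooth : ContDiffAt ℝ (⊤ : ℕ∞) (absQuantile μ) u := by
    rw [hzu] at hright hpos hloc
    refine hloc.congr_of_eventuallyEq ?_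
    filter_upwards [hright, hpos] with y hy hy0
    rw [← hμ.absQuantile_absCDF hα hα1 hF hy0, hy]
  refine ⟨hsmooth, HasDerivAt.of_local_left_inverse hsmooth.continuousAt hd hd0 ?_⟩
  filter_upwards [Ioo_mem_nhds hu.1 hu.2] with y hy
  exact hμ.absCDF_absQuantile hα hα1 hF hy

end IsStableLaw

/-- Second order Taylor expansion with a cubic remainder. -/
lemma ContDiffAt.exists_taylor_two {f : ℝ → ℝ} {q : ℝ} (hf : ContDiffAt ℝ 3 f q) :
    ∃ c C δ : ℝ, 0 < δ ∧ ∀ u, |u - q| < δ →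
      |f u - (f q + deriv f q * (u - q) + c * (u - q) ^ 2)| ≤ C * |u - q| ^ 3 := by
  obtain ⟨s, hs, hfs⟩ := hf.contDiffOn (m := 3) le_rfl (by simp)
  obtain ⟨r, hr, hball⟩ := Metric.mem_nhds_iff.mp hs
  have ho := taylor_isLittleO (n := 3) (convex_ball q r) (Metric.mem_ball_self hr)
    (hfs.mono hball)
  rw [Metric.isOpen_ball.nhdsWithin_eq (Metric.mem_ball_self hr)] at ho
  have h1 : iteratedDerivWithin 1 f (Metric.ball q r) q = deriv f q := by
    rw [iteratedDerivWithin_one, derivWithin_of_isOpen Metric.isOpen_ball (Metric.mem_ball_self hr)]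
  obtain ⟨δ, hδ, hb⟩ := Metric.eventually_nhds_iff.mp (ho.bound zero_lt_one)
  refine ⟨2⁻¹ * iteratedDerivWithin 2 f (Metric.ball q r) q,
    1 + |6⁻¹ * iteratedDerivWithin 3 f (Metric.ball q r) q|, δ, hδ, fun u hu => ?_⟩
  have hbu := hb (y := u) (by rwa [Real.dist_eq])
  simp only [taylorWithinEval_succ, taylor_within_zero_eval, Real.norm_eq_abs, abs_pow,
    one_mul, smul_eq_mul, zero_add, h1] at hbu
  norm_num at hbu
  set d2 := iteratedDerivWithin 2 f (Metric.ball q r) q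
  set d3 := iteratedDerivWithin 3 f (Metric.ball q r) q
  have h3 : |6⁻¹ * d3 * (u - q) ^ 3| = |6⁻¹ * d3| * |u - q| ^ 3 := by rw [abs_mul, abs_pow]
  calc _ = |(f u - (f q + (u - q) * deriv f q + 1 / 2 * (u - q) ^ 2 * d2
            + 1 / 6 * (u - q) ^ 3 * d3)) + 6⁻¹ * d3 * (u - q) ^ 3| := by congr 1; ring
    _ ≤ _ := abs_add_le _ _
    _ ≤ |u - q| ^ 3 + |6⁻¹ * d3| * |u - q| ^ 3 := by rw [h3]; gcongr
    _ = _ := by ring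

/-- The estimator as a function of the position `u` of the sample quantile on the probability
scale, expanded at `q`. The bound holds on the whole unit interval: it is Taylor's formula near `q`,
and elsewhere the tail bound gives `absQuantile μ u ^ α = O((1 - u)⁻¹)`. -/
lemma IsStableLaw.exists_quantile_expansion {α β F : ℝ} {μ : Measure ℝ}
    (hμ : IsStableLaw α β F μ) (hα : 0 < α) (hα1 : α ≠ 1) (hF : 0 < F) {q : ℝ}
    (hq : q ∈ Ioo 0 1) :
    ∃ c C : ℝ, 0 ≤ C ∧ ∀ u ∈ Ioo (0 : ℝ) 1,
      |(absQuantile μ u / absQuantile μ q) ^ α -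
        (1 + α / (absDensity μ (absQuantile μ q) * absQuantile μ q) * (u - q) + c * (u - q) ^ 2)|
        ≤ C * (|u - q| ^ 3 * (1 - u)⁻¹) := by
  set W := absQuantile μ q with hW
  have hWpos : 0 < W := hμ.absQuantile_pos hα hα1 hF hq
  set D := absDensity μ W with hD
  have hDpos : 0 < D := hμ.absDensity_pos hα hα1 hF hWpos
  set h : ℝ → ℝ := fun u => (absQuantile μ u / W) ^ α with hh
  obtain ⟨hsm, hder⟩ := hμ.contDiffAt_absQuantile hα hα1 hF hq
  have hq1 : h q = 1 := by simp only [hh]; rw [← hW, div_self hWpos.ne', Real.one_rpow]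
  have hhder : HasDerivAt h (α / (D * W)) q := by
    have h1 := (hder.div_const W).rpow_const (p := α) (Or.inl (by
      rw [← hW, div_self hWpos.ne']; exact one_ne_zero))
    convert h1 using 1
    rw [← hW, ← hD, div_self hWpos.ne', Real.one_rpow]
    field_simp
  have hhsm : ContDiffAt ℝ 3 h q := by
    refine ContDiffAt.rpow_const_of_ne ((hsm.of_le ?_).div_const W) ?_
    · exact WithTop.coe_le_coe.mpr (le_top : (3 : ℕ∞) ≤ ⊤)
    · rw [← hW, div_self hWpos.ne']; exact one_ne_zero
  obtain ⟨c, C₁, δ, hδ, hloc⟩ := hhsm.exists_taylor_two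
  rw [hhder.deriv, hq1] at hloc
  obtain ⟨C₂, hC₂, htail⟩ := hμ.exists_rpow_mul_one_sub_absCDF_le hα hF
  set a := α / (D * W) with ha
  have hapos : 0 < a := by positivity
  -- the bound on the whole remainder away from `q`, times `1 - u`
  set M : ℝ := C₂ / W ^ α + (1 + a + |c|) with hM
  have hMpos : 0 < M := by positivity
  have hWα : 0 < W ^ α := Real.rpow_pos_of_pos hWpos α
  refine ⟨c, |C₁| + M / δ ^ 3, by positivity, fun u hu => ?_⟩
  have hu1 : 0 < 1 - u := by linarith [hu.2]
  have hinv : 1 ≤ (1 - u)⁻¹ := (one_le_inv₀ hu1).mpr (by linarith [hu.1])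
  change |h u - _| ≤ _
  rcases lt_or_ge |u - q| δ with hlt | hge
  · refine (hloc u hlt).trans ?_
    calc C₁ * |u - q| ^ 3 ≤ (|C₁| + M / δ ^ 3) * |u - q| ^ 3 := by
          gcongr
          have : 0 ≤ M / δ ^ 3 := by positivity
          linarith [le_abs_self C₁]
      _ ≤ (|C₁| + M / δ ^ 3) * (|u - q| ^ 3 * (1 - u)⁻¹) := by
          gcongr
          exact le_mul_of_one_le_right (by positivity) hinv
  · have hQ := hμ.absQuantile_pos hα hα1 hF hu
    have ht := htail _ hQ
    rw [hμ.absCDF_absQuantile hα hα1 hF hu] at ht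
    have hhu : |h u| ≤ C₂ / W ^ α * (1 - u)⁻¹ := by
      simp only [hh]
      rw [Real.div_rpow hQ.le hWpos.le, abs_of_nonneg (by positivity)]
      rw [div_mul_eq_mul_div]
      gcongr
      rw [← div_eq_mul_inv, le_div_iff₀ hu1]
      exact ht
    have hd1 : |u - q| ≤ 1 := by
      rw [abs_le]; constructor <;> linarith [hu.1, hu.2, hq.1, hq.2]
    have hpoly : |1 + a * (u - q) + c * (u - q) ^ 2| ≤ 1 + a + |c| := by
      refine (abs_add_le _ _).trans (add_le_add ((abs_add_le _ _).trans ?_) ?_)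
      · rw [abs_one, abs_mul, abs_of_pos hapos]
        nlinarith
      · rw [abs_mul, abs_pow]
        exact mul_le_of_le_one_right (abs_nonneg c) (pow_le_one₀ (abs_nonneg _) hd1)
    have hδ3 : 1 ≤ |u - q| ^ 3 / δ ^ 3 := by
      rw [one_le_div (by positivity)]
      gcongr
    calc |h u - (1 + a * (u - q) + c * (u - q) ^ 2)|
        ≤ |h u| + |1 + a * (u - q) + c * (u - q) ^ 2| := abs_sub _ _
      _ ≤ C₂ / W ^ α * (1 - u)⁻¹ + (1 + a + |c|) * (1 - u)⁻¹ := by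
          gcongr
          exact hpoly.trans (le_mul_of_one_le_right (by positivity) hinv)
      _ = M * (1 - u)⁻¹ * 1 := by rw [hM]; ring
      _ ≤ M * (1 - u)⁻¹ * (|u - q| ^ 3 / δ ^ 3) := by gcongr
      _ = M / δ ^ 3 * (|u - q| ^ 3 * (1 - u)⁻¹) := by ring
      _ ≤ (|C₁| + M / δ ^ 3) * (|u - q| ^ 3 * (1 - u)⁻¹) := by
          gcongr
          linarith [abs_nonneg C₁]

/-! ### Moments of beta laws -/

section Beta

variable {a b : ℝ}

lemma beta_add_one_left (ha : 0 < a) (hb : 0 < b) : beta (a + 1) b = a / (a + b) * beta a b := by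
  have h : a + b ≠ 0 := by positivity
  have hG : Real.Gamma (a + b) ≠ 0 := (Real.Gamma_pos_of_pos (by positivity)).ne'
  rw [beta, beta, Real.Gamma_add_one ha.ne', add_right_comm, Real.Gamma_add_one h]
  field_simp

lemma beta_add_one_right (ha : 0 < a) (hb : 0 < b) : beta a (b + 1) = b / (a + b) * beta a b := by
  have h : a + b ≠ 0 := by positivity
  have hG : Real.Gamma (a + b) ≠ 0 := (Real.Gamma_pos_of_pos (by positivity)).ne'
  rw [beta, beta, Real.Gamma_add_one hb.ne', ← add_assoc, Real.Gamma_add_one h]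
  field_simp

lemma betaPDFReal_add_one_left (ha : 0 < a) (hb : 0 < b) (x : ℝ) :
    betaPDFReal (a + 1) b x = (a + b) / a * (betaPDFReal a b x * x) := by
  unfold betaPDFReal
  split_ifs with hx
  · have hB := (beta_pos ha hb).ne'
    rw [beta_add_one_left ha hb, add_sub_right_comm, Real.rpow_add_one hx.1.ne']
    field_simp
  · simp

lemma betaPDFReal_add_one_right (ha : 0 < a) (hb : 0 < b) (x : ℝ) :
    betaPDFReal a (b + 1) x = (a + b) / b * (betaPDFReal a b x * (1 - x)) := by
  unfold betaPDFReal
  split_ifs with hx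
  · have hB := (beta_pos ha hb).ne'
    have h1 : 1 - x ≠ 0 := by linarith [hx.2]
    rw [beta_add_one_right ha hb, add_sub_right_comm, Real.rpow_add_one h1]
    field_simp
  · simp

lemma betaPDFReal_nonneg (ha : 0 < a) (hb : 0 < b) (x : ℝ) : 0 ≤ betaPDFReal a b x := by
  by_cases hx : 0 < x ∧ x < 1
  · exact (betaPDFReal_pos hx.1 hx.2 ha hb).le
  · rw [betaPDFReal, if_neg hx]

lemma measurable_betaPDF (a b : ℝ) : Measurable (betaPDF a b) :=
  (measurable_betaPDFReal a b).ennreal_ofReal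

lemma integral_betaMeasure (ha : 0 < a) (hb : 0 < b) (g : ℝ → ℝ) :
    ∫ x, g x ∂(betaMeasure a b) = ∫ x, betaPDFReal a b x * g x := by
  rw [betaMeasure, integral_withDensity_eq_integral_toReal_smul (measurable_betaPDF a b)
    (Eventually.of_forall fun x => ENNReal.ofReal_lt_top)]
  refine integral_congr_ae (Eventually.of_forall fun x => ?_)
  simp [betaPDF, ENNReal.toReal_ofReal (betaPDFReal_nonneg ha hb x)]

lemma integrable_betaMeasure_iff (ha : 0 < a) (hb : 0 < b) (g : ℝ → ℝ) :
    Integrable g (betaMeasure a b) ↔ Integrable (fun x => betaPDFReal a b x * g x) := by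
  rw [betaMeasure, integrable_withDensity_iff_integrable_smul' (measurable_betaPDF a b)
    (Eventually.of_forall fun x => ENNReal.ofReal_lt_top)]
  refine integrable_congr (Eventually.of_forall fun x => ?_)
  simp [betaPDF, ENNReal.toReal_ofReal (betaPDFReal_nonneg ha hb x)]

lemma integral_betaMeasure_mul_self (ha : 0 < a) (hb : 0 < b) (g : ℝ → ℝ) :
    ∫ x, x * g x ∂(betaMeasure a b) = a / (a + b) * ∫ x, g x ∂(betaMeasure (a + 1) b) := by
  rw [integral_betaMeasure ha hb, integral_betaMeasure (by positivity) hb, ← integral_const_mul]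
  refine integral_congr_ae (Eventually.of_forall fun x => ?_)
  simp only [betaPDFReal_add_one_left ha hb]
  field_simp

lemma integral_betaMeasure_mul_one_sub (ha : 0 < a) (hb : 0 < b) (g : ℝ → ℝ) :
    ∫ x, g x ∂(betaMeasure a (b + 1)) = (a + b) / b * ∫ x, (1 - x) * g x ∂(betaMeasure a b) := by
  rw [integral_betaMeasure ha hb, integral_betaMeasure ha (by positivity), ← integral_const_mul]
  refine integral_congr_ae (Eventually.of_forall fun x => ?_)
  simp only [betaPDFReal_add_one_right ha hb]
  ring

lemma integrable_betaMeasure_add_one_right_iff (ha : 0 < a) (hb : 0 < b) (g : ℝ → ℝ) :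
    Integrable g (betaMeasure a (b + 1)) ↔ Integrable (fun x => (1 - x) * g x) (betaMeasure a b) := by
  have hc : (a + b) / b ≠ 0 := by positivity
  rw [integrable_betaMeasure_iff ha (by positivity), integrable_betaMeasure_iff ha hb]
  refine Iff.trans (integrable_congr (Eventually.of_forall fun x => ?_))
    (integrable_const_mul_iff (isUnit_iff_ne_zero.mpr hc) _)
  simp only [betaPDFReal_add_one_right ha hb]
  ring

lemma ae_mem_Ioo_betaMeasure (a b : ℝ) : ∀ᵐ x ∂(betaMeasure a b), x ∈ Ioo (0 : ℝ) 1 := by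
  rw [betaMeasure, ae_withDensity_iff (measurable_betaPDF a b)]
  refine Eventually.of_forall fun x hx => ?_
  by_contra h
  refine hx ?_
  rw [betaPDF, betaPDFReal, if_neg (by simpa only [mem_Ioo] using h), ENNReal.ofReal_zero]

lemma integrable_betaMeasure_of_continuous (ha : 0 < a) (hb : 0 < b) {g : ℝ → ℝ}
    (hg : Continuous g) : Integrable g (betaMeasure a b) := by
  have := isProbabilityMeasureBeta ha hb
  obtain ⟨C, hC⟩ := (isCompact_Icc (a := (0 : ℝ)) (b := 1)).exists_bound_of_continuousOn
    hg.continuousOn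
  refine Integrable.of_bound hg.aestronglyMeasurable C ?_
  filter_upwards [ae_mem_Ioo_betaMeasure a b] with x hx
  exact hC x (Ioo_subset_Icc_self hx)

/-- The first four moments of the beta law, in the form of the mean of a quartic polynomial. -/
lemma integral_quartic_betaMeasure (ha : 0 < a) (hb : 0 < b) (c₀ c₁ c₂ c₃ c₄ : ℝ) :
    ∫ x, (c₀ + c₁ * x + c₂ * x ^ 2 + c₃ * x ^ 3 + c₄ * x ^ 4) ∂(betaMeasure a b) =
      c₀ + c₁ * (a / (a + b)) + c₂ * (a * (a + 1) / ((a + b) * (a + b + 1)))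
      + c₃ * (a * (a + 1) * (a + 2) / ((a + b) * (a + b + 1) * (a + b + 2)))
      + c₄ * (a * (a + 1) * (a + 2) * (a + 3) /
        ((a + b) * (a + b + 1) * (a + b + 2) * (a + b + 3))) := by
  have hint : ∀ {a' : ℝ}, 0 < a' → ∀ n : ℕ, Integrable (fun x : ℝ => x ^ n) (betaMeasure a' b) :=
    fun ha' n => integrable_betaMeasure_of_continuous ha' hb (by fun_prop)
  have hM : ∀ {a' : ℝ}, 0 < a' → ∀ n : ℕ, ∫ x, x ^ (n + 1) ∂(betaMeasure a' b) =
      a' / (a' + b) * ∫ x, x ^ n ∂(betaMeasure (a' + 1) b) := by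
    intro a' ha' n
    rw [← integral_betaMeasure_mul_self ha' hb]
    simp only [pow_succ']
  have h0 : ∀ {a' : ℝ}, 0 < a' → ∫ x, x ^ 0 ∂(betaMeasure a' b) = 1 := by
    intro a' ha'
    have := isProbabilityMeasureBeta ha' hb
    simp
  have h1 : ∫ x, x ^ 1 ∂(betaMeasure a b) = a / (a + b) := by
    rw [hM ha, h0 (by positivity), mul_one]
  have h2 : ∫ x, x ^ 2 ∂(betaMeasure a b) = a * (a + 1) / ((a + b) * (a + b + 1)) := by
    rw [hM ha, hM (by positivity), h0 (by positivity)]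
    rw [show a + 1 + b = a + b + 1 by ring]
    field_simp
  have h3 : ∫ x, x ^ 3 ∂(betaMeasure a b) =
      a * (a + 1) * (a + 2) / ((a + b) * (a + b + 1) * (a + b + 2)) := by
    rw [hM ha, hM (by positivity), hM (by positivity), h0 (by positivity)]
    rw [show a + 1 + b = a + b + 1 by ring, show a + 1 + 1 + b = a + b + 2 by ring,
      show a + 1 + 1 = a + 2 by ring]
    field_simp
  have h4 : ∫ x, x ^ 4 ∂(betaMeasure a b) = a * (a + 1) * (a + 2) * (a + 3) /
        ((a + b) * (a + b + 1) * (a + b + 2) * (a + b + 3)) := by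
    rw [hM ha, hM (by positivity), hM (by positivity), hM (by positivity), h0 (by positivity)]
    rw [show a + 1 + b = a + b + 1 by ring, show a + 1 + 1 + b = a + b + 2 by ring,
      show a + 1 + 1 + 1 + b = a + b + 3 by ring,
      show a + 1 + 1 + 1 = a + 3 by ring, show a + 1 + 1 = a + 2 by ring]
    field_simp
  have e : (fun x : ℝ => c₀ + c₁ * x + c₂ * x ^ 2 + c₃ * x ^ 3 + c₄ * x ^ 4) =
      fun x => c₀ * x ^ 0 + c₁ * x ^ 1 + c₂ * x ^ 2 + c₃ * x ^ 3 + c₄ * x ^ 4 := by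
    funext x; ring
  rw [e, integral_add, integral_add, integral_add, integral_add]
  · simp only [integral_const_mul]
    rw [h0 ha, h1, h2, h3, h4, mul_one]
  all_goals first
    | exact integrable_betaMeasure_of_continuous ha hb (by fun_prop)

lemma integral_sub_betaMeasure (ha : 0 < a) (hb : 0 < b) (q : ℝ) :
    ∫ x, (x - q) ∂(betaMeasure a b) = a / (a + b) - q := by
  have h := integral_quartic_betaMeasure ha hb (-q) 1 0 0 0
  convert h using 1
  · congr 1; funext x; ring
  · ring

lemma integral_sub_sq_betaMeasure (ha : 0 < a) (hb : 0 < b) (q : ℝ) :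
    ∫ x, (x - q) ^ 2 ∂(betaMeasure a b) =
      a * b / ((a + b) ^ 2 * (a + b + 1)) + (a / (a + b) - q) ^ 2 := by
  have h := integral_quartic_betaMeasure ha hb (q ^ 2) (-2 * q) 1 0 0
  convert h using 1
  · congr 1; funext x; ring
  · field_simp; ring

lemma integral_sub_cube_betaMeasure (ha : 0 < a) (hb : 0 < b) (q : ℝ) :
    ∫ x, (x - q) ^ 3 ∂(betaMeasure a b) =
      2 * a * b * (b - a) / ((a + b) ^ 3 * (a + b + 1) * (a + b + 2))
      + 3 * (a / (a + b) - q) * (a * b / ((a + b) ^ 2 * (a + b + 1)))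
      + (a / (a + b) - q) ^ 3 := by
  have h := integral_quartic_betaMeasure ha hb (-q ^ 3) (3 * q ^ 2) (-3 * q) 1 0
  convert h using 1
  · congr 1; funext x; ring
  · field_simp; ring

lemma integral_sub_pow_four_betaMeasure (ha : 0 < a) (hb : 0 < b) (q : ℝ) :
    ∫ x, (x - q) ^ 4 ∂(betaMeasure a b) =
      3 * a * b * (2 * (a + b) ^ 2 + a * b * (a + b - 6))
        / ((a + b) ^ 4 * (a + b + 1) * (a + b + 2) * (a + b + 3))
      + 4 * (a / (a + b) - q)
        * (2 * a * b * (b - a) / ((a + b) ^ 3 * (a + b + 1) * (a + b + 2)))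
      + 6 * (a / (a + b) - q) ^ 2 * (a * b / ((a + b) ^ 2 * (a + b + 1)))
      + (a / (a + b) - q) ^ 4 := by
  have h := integral_quartic_betaMeasure ha hb (q ^ 4) (-4 * q ^ 3) (6 * q ^ 2) (-4 * q) 1
  convert h using 1
  · congr 1; funext x; ring
  · field_simp; ring

lemma beta_variance_le (ha : 0 < a) (hb : 0 < b) :
    a * b / ((a + b) ^ 2 * (a + b + 1)) ≤ 1 / (a + b) := by
  rw [div_le_div_iff₀ (by positivity) (by positivity)]
  have : a * b ≤ (a + b) ^ 2 := by nlinarith [mul_pos ha hb]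
  have h1 : a + b ≤ a + b + 1 := by linarith
  calc a * b * (a + b) ≤ (a + b) ^ 2 * (a + b + 1) :=
        mul_le_mul this h1 (by positivity) (by positivity)
    _ = _ := by ring

lemma abs_beta_third_le (ha : 0 < a) (hb : 0 < b) :
    |2 * a * b * (b - a) / ((a + b) ^ 3 * (a + b + 1) * (a + b + 2))| ≤ 2 / (a + b) ^ 2 := by
  have hn : 0 < a + b := by positivity
  rw [abs_div, abs_of_pos (show 0 < (a + b) ^ 3 * (a + b + 1) * (a + b + 2) by positivity),
    abs_mul, abs_of_pos (show 0 < 2 * a * b by positivity),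
    div_le_div_iff₀ (by positivity) (by positivity)]
  have h1 : a * b ≤ (a + b) ^ 2 := by nlinarith [mul_pos ha hb]
  have h2 : |b - a| ≤ a + b := abs_le.mpr ⟨by linarith, by linarith⟩
  calc 2 * a * b * |b - a| * (a + b) ^ 2 = 2 * (a * b) * |b - a| * (a + b) ^ 2 := by ring
    _ ≤ 2 * (a + b) ^ 2 * (a + b) * (a + b) ^ 2 := by gcongr
    _ = 2 * ((a + b) ^ 3 * (a + b) * (a + b)) := by ring
    _ ≤ 2 * ((a + b) ^ 3 * (a + b + 1) * (a + b + 2)) := by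
        generalize a + b = n at hn
        gcongr <;> linarith

lemma beta_fourth_le (ha : 0 < a) (hb : 0 < b) (hn : 1 ≤ a + b) :
    3 * a * b * (2 * (a + b) ^ 2 + a * b * (a + b - 6))
      / ((a + b) ^ 4 * (a + b + 1) * (a + b + 2) * (a + b + 3)) ≤ 9 / (a + b) ^ 2 := by
  have hn0 : 0 < a + b := by positivity
  rw [div_le_div_iff₀ (by positivity) (by positivity)]
  have h1 : a * b ≤ (a + b) ^ 2 := by nlinarith [mul_pos ha hb]
  have h2 : 2 * (a + b) ^ 2 + a * b * (a + b - 6) ≤ 3 * (a + b) ^ 3 := by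
    have : a * b * (a + b - 6) ≤ a * b * (a + b) :=
      mul_le_mul_of_nonneg_left (by linarith) (by positivity)
    have : a * b * (a + b) ≤ (a + b) ^ 2 * (a + b) := by gcongr
    have : (a + b) ^ 2 * 1 ≤ (a + b) ^ 2 * (a + b) := by gcongr
    nlinarith
  calc 3 * a * b * (2 * (a + b) ^ 2 + a * b * (a + b - 6)) * (a + b) ^ 2
      = 3 * (a * b) * (2 * (a + b) ^ 2 + a * b * (a + b - 6)) * (a + b) ^ 2 := by ring
    _ ≤ 3 * (a * b) * (3 * (a + b) ^ 3) * (a + b) ^ 2 := by gcongr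
    _ ≤ 3 * (a + b) ^ 2 * (3 * (a + b) ^ 3) * (a + b) ^ 2 := by gcongr
    _ = 9 * ((a + b) ^ 4 * (a + b) * (a + b) * (a + b)) := by ring
    _ ≤ 9 * ((a + b) ^ 4 * (a + b + 1) * (a + b + 2) * (a + b + 3)) := by
        generalize a + b = n at hn0
        gcongr <;> linarith

lemma integral_sub_sq_betaMeasure_le (ha : 0 < a) (hb : 0 < b) (hn : 1 ≤ a + b) {q : ℝ}
    (hq : |a / (a + b) - q| ≤ 2 / (a + b)) :
    ∫ x, (x - q) ^ 2 ∂(betaMeasure a b) ≤ 5 / (a + b) := by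
  have hn0 : 0 < a + b := by positivity
  rw [integral_sub_sq_betaMeasure ha hb]
  have h1 := beta_variance_le ha hb
  have h2 : (a / (a + b) - q) ^ 2 ≤ (2 / (a + b)) ^ 2 := by rw [← sq_abs]; gcongr
  have h3 : (2 / (a + b)) ^ 2 ≤ 4 / (a + b) := by
    rw [div_pow, div_le_div_iff₀ (by positivity) hn0]; nlinarith
  calc _ ≤ 1 / (a + b) + 4 / (a + b) := by linarith
    _ = _ := by ring

lemma abs_integral_sub_cube_betaMeasure_le (ha : 0 < a) (hb : 0 < b) (hn : 1 ≤ a + b) {q : ℝ}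
    (hq : |a / (a + b) - q| ≤ 2 / (a + b)) :
    |∫ x, (x - q) ^ 3 ∂(betaMeasure a b)| ≤ 16 / (a + b) ^ 2 := by
  have hn0 : 0 < a + b := by positivity
  rw [integral_sub_cube_betaMeasure ha hb]
  set e := a / (a + b) - q
  have h1 := beta_variance_le ha hb
  have h0 : 0 ≤ a * b / ((a + b) ^ 2 * (a + b + 1)) := by positivity
  set v := a * b / ((a + b) ^ 2 * (a + b + 1))
  have h2 : |3 * e * v| ≤ 3 * (2 / (a + b)) * (1 / (a + b)) := by
    rw [abs_mul, abs_mul, abs_of_nonneg h0, abs_of_pos (by norm_num : (0 : ℝ) < 3)]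
    gcongr
  have h3 : |e ^ 3| ≤ 8 / (a + b) ^ 2 := by
    rw [abs_pow]
    calc |e| ^ 3 ≤ (2 / (a + b)) ^ 3 := by gcongr
      _ ≤ _ := by
        rw [div_pow, div_le_div_iff₀ (by positivity) (by positivity)]
        have : (a + b) ^ 2 * 1 ≤ (a + b) ^ 2 * (a + b) := by gcongr
        nlinarith
  calc _ ≤ 2 / (a + b) ^ 2 + 3 * (2 / (a + b)) * (1 / (a + b)) + 8 / (a + b) ^ 2 :=
        (abs_add_le _ _).trans (add_le_add ((abs_add_le _ _).trans
          (add_le_add (abs_beta_third_le ha hb) h2)) h3)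
    _ = _ := by field_simp; ring

lemma integral_sub_pow_four_betaMeasure_le (ha : 0 < a) (hb : 0 < b) (hn : 1 ≤ a + b) {q : ℝ}
    (hq : |a / (a + b) - q| ≤ 2 / (a + b)) :
    ∫ x, (x - q) ^ 4 ∂(betaMeasure a b) ≤ 65 / (a + b) ^ 2 := by
  have hn0 : 0 < a + b := by positivity
  rw [integral_sub_pow_four_betaMeasure ha hb]
  have hthird := abs_beta_third_le ha hb
  have hfourth := beta_fourth_le ha hb hn
  set e := a / (a + b) - q
  have h1 := beta_variance_le ha hb
  have h0 : 0 ≤ a * b / ((a + b) ^ 2 * (a + b + 1)) := by positivity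
  set v := a * b / ((a + b) ^ 2 * (a + b + 1))
  set t := 2 * a * b * (b - a) / ((a + b) ^ 3 * (a + b + 1) * (a + b + 2))
  have he1 : |e| ≤ 2 := hq.trans ((div_le_iff₀ hn0).mpr (by linarith))
  have he2 : e ^ 2 ≤ 4 / (a + b) := by
    rw [← sq_abs]
    calc |e| ^ 2 = |e| * |e| := sq _
      _ ≤ 2 * (2 / (a + b)) := by gcongr
      _ = _ := by ring
  have h2 : 4 * e * t ≤ 16 / (a + b) ^ 2 := by
    calc 4 * e * t ≤ |4 * e * t| := le_abs_self _
      _ = 4 * |e| * |t| := by rw [abs_mul, abs_mul, abs_of_pos (by norm_num : (0 : ℝ) < 4)]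
      _ ≤ 4 * 2 * (2 / (a + b) ^ 2) := by gcongr
      _ = _ := by ring
  have h3 : 6 * e ^ 2 * v ≤ 24 / (a + b) ^ 2 := by
    calc 6 * e ^ 2 * v ≤ 6 * (4 / (a + b)) * (1 / (a + b)) := by gcongr
      _ = _ := by field_simp; norm_num
  have h4 : e ^ 4 ≤ 16 / (a + b) ^ 2 := by
    calc e ^ 4 = e ^ 2 * e ^ 2 := by ring
      _ ≤ 4 / (a + b) * (4 / (a + b)) := by gcongr
      _ = _ := by field_simp; norm_num
  calc _ ≤ 9 / (a + b) ^ 2 + 16 / (a + b) ^ 2 + 24 / (a + b) ^ 2 + 16 / (a + b) ^ 2 := by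
        linarith
    _ = _ := by ring

/-- Dividing by `(1 - x) ^ 2` lowers the second parameter of a beta law by `2`. -/
lemma integral_mul_inv_one_sub_sq_betaMeasure (ha : 0 < a) (hb : 0 < b) {g : ℝ → ℝ}
    (hg : Continuous g) :
    Integrable (fun x => g x * ((1 - x)⁻¹) ^ 2) (betaMeasure a (b + 1 + 1)) ∧
    ∫ x, g x * ((1 - x)⁻¹) ^ 2 ∂(betaMeasure a (b + 1 + 1)) =
      (a + b + 1) / (b + 1) * ((a + b) / b) * ∫ x, g x ∂(betaMeasure a b) := by
  have hae : (fun x => (1 - x) * ((1 - x) * (g x * ((1 - x)⁻¹) ^ 2)))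
      =ᵐ[betaMeasure a b] g := by
    filter_upwards [ae_mem_Ioo_betaMeasure a b] with x hx
    have : 1 - x ≠ 0 := by linarith [hx.2]
    field_simp
  constructor
  · rw [integrable_betaMeasure_add_one_right_iff ha (by positivity),
      integrable_betaMeasure_add_one_right_iff ha hb, integrable_congr hae]
    exact integrable_betaMeasure_of_continuous ha hb hg
  · rw [integral_betaMeasure_mul_one_sub ha (by positivity),
      integral_betaMeasure_mul_one_sub ha hb, integral_congr_ae hae]
    ring

end Beta

/-! ### The variance of a smooth function of a beta variable -/

/-- The delta method with an error of second order, for laws on the unit interval concentrating at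
`q`, with `r` in the role of the inverse sample size. Up to an error whose mean is of order `r ^ 2`
the square of `h - 1` is `a² D² + 2 a c D³`, where `D x = x - q`, and the mean of `h - 1` is of
order `r`. -/
lemma memLp_and_abs_variance_sub_le {m : Measure ℝ} [IsProbabilityMeasure m]
    (hm : ∀ᵐ x ∂m, x ∈ Ioo (0 : ℝ) 1) {h : ℝ → ℝ} (hh : AEStronglyMeasurable h m)
    {q a c C s ε r : ℝ} (hq : q ∈ Ioo (0 : ℝ) 1) (hC : 0 ≤ C)
    (hexp : ∀ u ∈ Ioo (0 : ℝ) 1,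
      |h u - (1 + a * (u - q) + c * (u - q) ^ 2)| ≤ C * (|u - q| ^ 3 * (1 - u)⁻¹))
    (h1 : |∫ x, (x - q) ∂m| ≤ ε * r) (h2 : |∫ x, (x - q) ^ 2 ∂m - s * r| ≤ ε * r ^ 2)
    (h3 : |∫ x, (x - q) ^ 3 ∂m| ≤ ε * r ^ 2)
    (hi2 : Integrable (fun x => (x - q) ^ 2 * ((1 - x)⁻¹) ^ 2) m)
    (hi4 : Integrable (fun x => (x - q) ^ 4 * ((1 - x)⁻¹) ^ 2) m)
    (hw2 : ∫ x, (x - q) ^ 2 * ((1 - x)⁻¹) ^ 2 ∂m ≤ ε * r)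
    (hw4 : ∫ x, (x - q) ^ 4 * ((1 - x)⁻¹) ^ 2 ∂m ≤ ε * r ^ 2) :
    MemLp h 2 m ∧ |variance h m - a ^ 2 * (s * r)| ≤
      (a ^ 2 * ε + 2 * |a * c| * ε + (c ^ 2 + 2 * |a| * C + 2 * |c| * C + C ^ 2) * ε
        + ((|a| + |c| + C) * ε) ^ 2) * r ^ 2 := by
  have hint : ∀ g : ℝ → ℝ, Continuous g → Integrable g m := by
    intro g hg
    obtain ⟨B, hB⟩ := (isCompact_Icc (a := (0 : ℝ)) (b := 1)).exists_bound_of_continuousOn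
      hg.continuousOn
    refine Integrable.of_bound hg.aestronglyMeasurable B ?_
    filter_upwards [hm] with x hx
    exact hB x (Ioo_subset_Icc_self hx)
  set A : ℝ := c ^ 2 + 2 * |a| * C + 2 * |c| * C + C ^ 2 with hA
  set X : ℝ → ℝ := fun x => h x - 1 with hX
  have hXm : AEStronglyMeasurable X m := hh.sub aestronglyMeasurable_const
  -- pointwise bounds: `1 ≤ (1 - x)⁻¹` and `|x - q| ≤ 1` let all error terms be absorbed
  have hpt : ∀ x ∈ Ioo (0 : ℝ) 1,
      |X x ^ 2 - (a ^ 2 * (x - q) ^ 2 + 2 * (a * c) * (x - q) ^ 3)|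
          ≤ A * ((x - q) ^ 4 * ((1 - x)⁻¹) ^ 2) ∧
      |X x - a * (x - q)| ≤ (|c| + C) * ((x - q) ^ 2 * ((1 - x)⁻¹) ^ 2) := by
    intro x hx
    have hx1 : 0 < 1 - x := by linarith [hx.2]
    have hV : 1 ≤ (1 - x)⁻¹ := (one_le_inv₀ hx1).mpr (by linarith [hx.1])
    have hd : |x - q| ≤ 1 := by
      rw [abs_le]; constructor <;> linarith [hx.1, hx.2, hq.1, hq.2]
    have hR := hexp x hx
    set V := (1 - x)⁻¹
    set D := x - q
    set R := h x - (1 + a * D + c * D ^ 2) with hRdef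
    have hXx : X x = a * D + c * D ^ 2 + R := by simp only [hX, hRdef]; ring
    have hd0 := abs_nonneg D
    have hD2 : D ^ 2 = |D| ^ 2 := (sq_abs D).symm
    have hD4 : D ^ 4 = |D| ^ 4 := by rw [show D ^ 4 = (D ^ 2) ^ 2 by ring, hD2]; ring
    have hV2 : 1 ≤ V ^ 2 := one_le_pow₀ hV
    have hVV : V ≤ V ^ 2 := by nlinarith
    constructor
    · have e : X x ^ 2 - (a ^ 2 * D ^ 2 + 2 * (a * c) * D ^ 3) =
          c ^ 2 * D ^ 4 + 2 * a * D * R + 2 * c * D ^ 2 * R + R ^ 2 := by rw [hXx]; ring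
      rw [e]
      have b1 : |c ^ 2 * D ^ 4| ≤ c ^ 2 * (|D| ^ 4 * V ^ 2) := by
        rw [abs_of_nonneg (by positivity), hD4]
        gcongr
        exact le_mul_of_one_le_right (by positivity) hV2
      have b2 : |2 * a * D * R| ≤ 2 * |a| * C * (|D| ^ 4 * V ^ 2) := by
        rw [abs_mul, abs_mul, abs_mul, abs_two]
        calc 2 * |a| * |D| * |R| ≤ 2 * |a| * |D| * (C * (|D| ^ 3 * V ^ 2)) := by
              gcongr; exact hR.trans (by gcongr)
          _ = _ := by ring
      have b3 : |2 * c * D ^ 2 * R| ≤ 2 * |c| * C * (|D| ^ 4 * V ^ 2) := by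
        rw [abs_mul, abs_mul, abs_mul, abs_two, abs_pow]
        calc 2 * |c| * |D| ^ 2 * |R| ≤ 2 * |c| * |D| ^ 2 * (C * (|D| ^ 3 * V ^ 2)) := by
              gcongr; exact hR.trans (by gcongr)
          _ = 2 * |c| * C * (|D| ^ 4 * |D| * V ^ 2) := by ring
          _ ≤ 2 * |c| * C * (|D| ^ 4 * 1 * V ^ 2) := by gcongr
          _ = _ := by ring
      have b4 : |R ^ 2| ≤ C ^ 2 * (|D| ^ 4 * V ^ 2) := by
        rw [abs_pow]
        calc |R| ^ 2 ≤ (C * (|D| ^ 3 * V)) ^ 2 := by gcongr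
          _ = C ^ 2 * (|D| ^ 4 * |D| ^ 2 * V ^ 2) := by ring
          _ ≤ C ^ 2 * (|D| ^ 4 * 1 * V ^ 2) := by
              gcongr
              exact pow_le_one₀ hd0 hd
          _ = _ := by ring
      calc _ ≤ |c ^ 2 * D ^ 4| + |2 * a * D * R| + |2 * c * D ^ 2 * R| + |R ^ 2| :=
            (abs_add_le _ _).trans (add_le_add_left ((abs_add_le _ _).trans
              (add_le_add_left (abs_add_le _ _) _)) _)
        _ ≤ _ := by rw [hD4] at b1 ⊢; rw [hA]; linarith
    · have e : X x - a * D = c * D ^ 2 + R := by rw [hXx]; ring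
      rw [e, hD2]
      have b1 : |c * |D| ^ 2| ≤ |c| * (|D| ^ 2 * V ^ 2) := by
        rw [abs_mul, abs_of_nonneg (sq_nonneg |D|)]
        gcongr
        exact le_mul_of_one_le_right (by positivity) hV2
      have b2 : |R| ≤ C * (|D| ^ 2 * V ^ 2) := by
        refine hR.trans ?_
        calc C * (|D| ^ 3 * V) = C * (|D| ^ 2 * |D| * V) := by ring
          _ ≤ C * (|D| ^ 2 * 1 * V ^ 2) := by gcongr
          _ = _ := by ring
      calc _ ≤ |c * |D| ^ 2| + |R| := abs_add_le _ _
        _ ≤ _ := by linarith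
  have hmain : Integrable (fun x => a ^ 2 * (x - q) ^ 2 + 2 * (a * c) * (x - q) ^ 3) m :=
    hint _ (by fun_prop)
  have hrest : Integrable
      (fun x => X x ^ 2 - (a ^ 2 * (x - q) ^ 2 + 2 * (a * c) * (x - q) ^ 3)) m := by
    refine (hi4.const_mul A).mono' ((hXm.pow 2).sub hmain.aestronglyMeasurable) ?_
    filter_upwards [hm] with x hx
    exact (hpt x hx).1
  have hX2 : Integrable (fun x => X x ^ 2) m :=
    (hrest.add hmain).congr (Eventually.of_forall fun x => by simp)
  have hXL : MemLp X 2 m := (memLp_two_iff_integrable_sq hXm).mpr hX2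
  have hXi : Integrable X m := hXL.integrable one_le_two
  have hhL : MemLp h 2 m := by
    have := hXL.add (memLp_const (1 : ℝ))
    refine this.ae_eq (Eventually.of_forall fun x => ?_)
    simp [hX]
  have hvar : variance h m = ∫ x, X x ^ 2 ∂m - (∫ x, X x ∂m) ^ 2 := by
    have : variance X m = variance h m := variance_sub_const hh 1
    rw [← this, variance_eq_sub hXL]
    rfl
  have hsq : |∫ x, X x ^ 2 ∂m -
      (a ^ 2 * ∫ x, (x - q) ^ 2 ∂m + 2 * (a * c) * ∫ x, (x - q) ^ 3 ∂m)| ≤ A * (ε * r ^ 2) := by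
    rw [← integral_const_mul, ← integral_const_mul, ← integral_add (hint _ (by fun_prop))
      (hint _ (by fun_prop)), ← integral_sub hX2 hmain]
    calc _ ≤ ∫ x, A * ((x - q) ^ 4 * ((1 - x)⁻¹) ^ 2) ∂m := by
          rw [← Real.norm_eq_abs]
          refine norm_integral_le_of_norm_le (hi4.const_mul A) ?_
          filter_upwards [hm] with x hx
          exact (hpt x hx).1
      _ = A * ∫ x, (x - q) ^ 4 * ((1 - x)⁻¹) ^ 2 ∂m := integral_const_mul _ _
      _ ≤ _ := by gcongr
  have hmean : |∫ x, X x ∂m| ≤ (|a| + |c| + C) * ε * r := by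
    have hd : |∫ x, X x ∂m - a * ∫ x, (x - q) ∂m| ≤ (|c| + C) * (ε * r) := by
      rw [← integral_const_mul, ← integral_sub hXi (hint _ (by fun_prop))]
      calc _ ≤ ∫ x, (|c| + C) * ((x - q) ^ 2 * ((1 - x)⁻¹) ^ 2) ∂m := by
            rw [← Real.norm_eq_abs]
            refine norm_integral_le_of_norm_le (hi2.const_mul _) ?_
            filter_upwards [hm] with x hx
            exact (hpt x hx).2
        _ = (|c| + C) * ∫ x, (x - q) ^ 2 * ((1 - x)⁻¹) ^ 2 ∂m := integral_const_mul _ _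
        _ ≤ _ := by gcongr
    have ha : |a * ∫ x, (x - q) ∂m| ≤ |a| * (ε * r) := by
      rw [abs_mul]; gcongr
    calc |∫ x, X x ∂m| = |(∫ x, X x ∂m - a * ∫ x, (x - q) ∂m) + a * ∫ x, (x - q) ∂m| := by
          rw [sub_add_cancel]
      _ ≤ (|c| + C) * (ε * r) + |a| * (ε * r) := (abs_add_le _ _).trans (add_le_add hd ha)
      _ = _ := by ring
  refine ⟨hhL, ?_⟩
  rw [hvar]
  set E1 := ∫ x, X x ∂m
  set E2 := ∫ x, X x ^ 2 ∂m
  set D2 := ∫ x, (x - q) ^ 2 ∂m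
  set D3 := ∫ x, (x - q) ^ 3 ∂m
  have t1 : |a ^ 2 * (D2 - s * r)| ≤ a ^ 2 * (ε * r ^ 2) := by
    rw [abs_mul, abs_of_nonneg (sq_nonneg a)]; gcongr
  have t2 : |2 * (a * c) * D3| ≤ 2 * |a * c| * (ε * r ^ 2) := by
    rw [abs_mul, abs_mul, abs_two]; gcongr
  have t3 : |E1 ^ 2| ≤ ((|a| + |c| + C) * ε * r) ^ 2 := by
    rw [abs_pow]; gcongr
  calc |E2 - E1 ^ 2 - a ^ 2 * (s * r)|
      = |(E2 - (a ^ 2 * D2 + 2 * (a * c) * D3)) + a ^ 2 * (D2 - s * r) + 2 * (a * c) * D3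
          + -(E1 ^ 2)| := by congr 1; ring
    _ ≤ A * (ε * r ^ 2) + a ^ 2 * (ε * r ^ 2) + 2 * |a * c| * (ε * r ^ 2)
          + ((|a| + |c| + C) * ε * r) ^ 2 := by
        refine (abs_add_le _ _).trans (add_le_add ((abs_add_le _ _).trans (add_le_add
          ((abs_add_le _ _).trans (add_le_add hsq t1)) t2)) ?_)
        rwa [abs_neg]
    _ = _ := by ring

/-- The mean square of the deviation from `q` of a beta variable with parameters `a + b = k + 1` and
mean close to `q`. -/
lemma abs_integral_sub_sq_betaMeasure_sub_le {a b k q : ℝ} (ha : 0 < a) (hb : 0 < b)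
    (hq : q ∈ Ioo (0 : ℝ) 1) (hk : 1 ≤ k) (hsum : a + b = k + 1)
    (he : |a / (a + b) - q| ≤ 1 / (a + b)) :
    |∫ x, (x - q) ^ 2 ∂(betaMeasure a b) - q * (1 - q) * (1 / k)| ≤ 5 * (1 / k) ^ 2 := by
  have hq1 : 0 < 1 - q := by linarith [hq.2]
  have hk0 : 0 < k := by linarith
  rw [integral_sub_sq_betaMeasure ha hb]
  have hbe : b = (k + 1) - a := by linarith
  set e := a / (a + b) - q with hedef
  have hp : a = (q + e) * (k + 1) := by
    rw [hedef, hsum]; field_simp; ring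
  have hv : a * b / ((a + b) ^ 2 * (a + b + 1)) =
      (q + e) * (1 - (q + e)) * (1 / (k + 2)) := by
    rw [hsum, hbe, hp]; field_simp; ring
  have hek : |e| ≤ 1 / k := he.trans (by rw [hsum]; gcongr; linarith)
  have hk1 : 1 / k ≤ 1 := by rw [div_le_one hk0]; linarith
  have he1 : |e| ≤ 1 := hek.trans hk1
  have hqq : |1 - 2 * q - e| ≤ 2 := by
    rw [abs_le] at he1 ⊢
    constructor <;> linarith [hq.1, hq.2]
  have hq4 : |q * (1 - q)| ≤ 1 := by
    rw [abs_of_pos (mul_pos hq.1 hq1)]; nlinarith [hq.1, hq.2]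
  have h2 : |1 / (k + 2)| ≤ 1 / k := by
    rw [abs_of_pos (by positivity)]; gcongr; linarith
  have h3 : |1 / (k + 2) - 1 / k| ≤ 2 * (1 / k) ^ 2 := by
    rw [abs_sub_comm, abs_of_nonneg (sub_nonneg.mpr (by gcongr; linarith))]
    have : 1 / k - 1 / (k + 2) = 2 * (1 / k) * (1 / (k + 2)) := by field_simp; ring
    rw [this, sq, ← mul_assoc]
    gcongr
    linarith
  rw [hv]
  calc |(q + e) * (1 - (q + e)) * (1 / (k + 2)) + e ^ 2 - q * (1 - q) * (1 / k)|
      = |e * (1 - 2 * q - e) * (1 / (k + 2))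
          + q * (1 - q) * (1 / (k + 2) - 1 / k) + e ^ 2| := by congr 1; ring
    _ ≤ |e| * |1 - 2 * q - e| * |1 / (k + 2)|
          + |q * (1 - q)| * |1 / (k + 2) - 1 / k| + |e| ^ 2 := by
        refine (abs_add_le _ _).trans (add_le_add ((abs_add_le _ _).trans ?_) ?_)
        · rw [abs_mul, abs_mul, abs_mul (q * (1 - q))]
        · rw [abs_pow]
    _ ≤ 1 / k * 2 * (1 / k) + 1 * (2 * (1 / k) ^ 2) + (1 / k) ^ 2 := by gcongr
    _ = 5 * (1 / k) ^ 2 := by ring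

/-- The moment bounds for the law `Beta (⌈q k⌉, k - ⌈q k⌉ + 1)` of the sample quantile of uniform
variables, including the moments weighted by `(1 - x) ^ (-2)` that control the upper tail. -/
lemma exists_beta_moment_bounds {q : ℝ} (hq : q ∈ Ioo (0 : ℝ) 1) :
    ∃ (ε : ℝ) (K : ℕ), 0 < K ∧ ∀ k : ℕ, K ≤ k →
      let m := betaMeasure (⌈q * (k : ℝ)⌉₊ : ℝ) ((k : ℝ) - ⌈q * (k : ℝ)⌉₊ + 1)
      |∫ x, (x - q) ∂m| ≤ ε * (1 / k) ∧
      |∫ x, (x - q) ^ 2 ∂m - q * (1 - q) * (1 / k)| ≤ ε * (1 / k) ^ 2 ∧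
      |∫ x, (x - q) ^ 3 ∂m| ≤ ε * (1 / k) ^ 2 ∧
      Integrable (fun x => (x - q) ^ 2 * ((1 - x)⁻¹) ^ 2) m ∧
      Integrable (fun x => (x - q) ^ 4 * ((1 - x)⁻¹) ^ 2) m ∧
      ∫ x, (x - q) ^ 2 * ((1 - x)⁻¹) ^ 2 ∂m ≤ ε * (1 / k) ∧
      ∫ x, (x - q) ^ 4 * ((1 - x)⁻¹) ^ 2 ∂m ≤ ε * (1 / k) ^ 2 := by
  have hq1 : 0 < 1 - q := by linarith [hq.2]
  -- for `k ≥ 4 / (1 - q)` the lowered parameter `b - 2` is at least `(1 - q) k / 2`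
  refine ⟨1040 / (1 - q) ^ 2, max 2 ⌈4 / (1 - q)⌉₊, by positivity, fun k hk => ?_⟩
  have hk2 : (2 : ℝ) ≤ k := by exact_mod_cast (le_max_left _ _).trans hk
  have hk4 : 4 ≤ (1 - q) * k := by
    have h1 : 4 / (1 - q) ≤ k := (Nat.le_ceil _).trans (by
      exact_mod_cast (le_max_right _ _).trans hk)
    rw [div_le_iff₀ hq1] at h1
    linarith
  have hk0 : (0 : ℝ) < k := by linarith
  set a : ℝ := (⌈q * (k : ℝ)⌉₊ : ℝ) with ha
  have ha1 : q * k ≤ a := Nat.le_ceil _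
  have ha2 : a < q * k + 1 := Nat.ceil_lt_add_one (by have := hq.1; positivity)
  have ha0 : 0 < a := lt_of_lt_of_le (mul_pos hq.1 hk0) ha1
  set b : ℝ := (k : ℝ) - a - 1 with hb
  have hbk : (1 - q) * k / 2 ≤ b := by rw [hb]; linarith
  have hb0 : 0 < b := by linarith
  have hbb : (k : ℝ) - a + 1 = b + 1 + 1 := by rw [hb]; ring
  simp only
  rw [hbb]
  have hε : 1040 ≤ 1040 / (1 - q) ^ 2 := by
    rw [le_div_iff₀ (by positivity)]
    have : (1 - q) ^ 2 ≤ 1 := pow_le_one₀ hq1.le (by linarith [hq.1])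
    linarith
  have hsum : a + (b + 1 + 1) = k + 1 := by rw [hb]; ring
  have hsum' : a + b = k - 1 := by rw [hb]; ring
  have he : |a / (a + (b + 1 + 1)) - q| ≤ 1 / (a + (b + 1 + 1)) := by
    rw [hsum, div_sub' (by positivity), abs_div, abs_of_pos (by positivity : (0 : ℝ) < k + 1)]
    gcongr
    rw [abs_le]
    constructor <;> nlinarith [hq.1, hq.2]
  have he2 : |a / (a + (b + 1 + 1)) - q| ≤ 2 / (a + (b + 1 + 1)) :=
    he.trans (by gcongr; norm_num)
  have he' : |a / (a + b) - q| ≤ 2 / (a + b) := by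
    have hpos : (0 : ℝ) < k - 1 := by linarith
    rw [hsum', div_sub' hpos.ne', abs_div, abs_of_pos hpos]
    gcongr
    rw [abs_le]
    constructor <;> nlinarith [hq.1, hq.2]
  have hn : 1 ≤ a + (b + 1 + 1) := by rw [hsum]; linarith
  have hn' : 1 ≤ a + b := by rw [hsum']; linarith
  have hb2 : 0 < b + 1 + 1 := by linarith
  have hr : (a + b + 1) / (b + 1) * ((a + b) / b) ≤ 4 / (1 - q) ^ 2 := by
    have hc1 : (a + b + 1) / (b + 1) ≤ 2 / (1 - q) := by
      rw [div_le_div_iff₀ (by linarith) hq1]; nlinarith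
    have hc2 : (a + b) / b ≤ 2 / (1 - q) := by
      rw [div_le_div_iff₀ hb0 hq1]; nlinarith
    calc _ ≤ 2 / (1 - q) * (2 / (1 - q)) := by gcongr
      _ = _ := by field_simp; norm_num
  have hr0 : 0 ≤ (a + b + 1) / (b + 1) * ((a + b) / b) := by positivity
  have hkhalf : 1 / (a + b) ≤ 2 * (1 / (k : ℝ)) := by
    rw [hsum', mul_one_div, div_le_div_iff₀ (by linarith) hk0]; linarith
  refine ⟨?_, ?_, ?_, ?_, ?_, ?_, ?_⟩
  · rw [integral_sub_betaMeasure ha0 hb2]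
    refine he.trans ?_
    rw [hsum]
    calc 1 / ((k : ℝ) + 1) ≤ 1 * (1 / (k : ℝ)) := by rw [one_mul]; gcongr; linarith
      _ ≤ _ := by gcongr; linarith
  · refine (abs_integral_sub_sq_betaMeasure_sub_le ha0 hb2 hq (by linarith) hsum he).trans ?_
    gcongr
    linarith
  · refine (abs_integral_sub_cube_betaMeasure_le ha0 hb2 hn he2).trans ?_
    rw [hsum]
    calc 16 / ((k : ℝ) + 1) ^ 2 ≤ 16 / (k : ℝ) ^ 2 := by gcongr; linarith
      _ = 16 * (1 / (k : ℝ)) ^ 2 := by field_simp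
      _ ≤ _ := by gcongr; linarith
  · exact (integral_mul_inv_one_sub_sq_betaMeasure (g := fun x => (x - q) ^ 2) ha0 hb0
      (by fun_prop)).1
  · exact (integral_mul_inv_one_sub_sq_betaMeasure (g := fun x => (x - q) ^ 4) ha0 hb0
      (by fun_prop)).1
  · rw [(integral_mul_inv_one_sub_sq_betaMeasure (g := fun x => (x - q) ^ 2) ha0 hb0
      (by fun_prop)).2]
    calc _ ≤ 4 / (1 - q) ^ 2 * (5 / (a + b)) := by
          gcongr
          exact integral_sub_sq_betaMeasure_le ha0 hb0 hn' he'
      _ = 20 / (1 - q) ^ 2 * (1 / (a + b)) := by ring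
      _ ≤ 20 / (1 - q) ^ 2 * (2 * (1 / (k : ℝ))) := by gcongr
      _ = 40 / (1 - q) ^ 2 * (1 / (k : ℝ)) := by ring
      _ ≤ _ := by gcongr; norm_num
  · rw [(integral_mul_inv_one_sub_sq_betaMeasure (g := fun x => (x - q) ^ 4) ha0 hb0
      (by fun_prop)).2]
    calc _ ≤ 4 / (1 - q) ^ 2 * (65 / (a + b) ^ 2) := by
          gcongr
          exact integral_sub_pow_four_betaMeasure_le ha0 hb0 hn' he'
      _ = 260 / (1 - q) ^ 2 * (1 / (a + b)) ^ 2 := by field_simp; norm_num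
      _ ≤ 260 / (1 - q) ^ 2 * (2 * (1 / (k : ℝ))) ^ 2 := by gcongr
      _ = 1040 / (1 - q) ^ 2 * (1 / (k : ℝ)) ^ 2 := by ring

/-! ### Order statistics and beta laws -/

section OrderStatistic

variable {k : ℕ}

/-- The infimum in the definition of the order statistic is attained. -/
lemma orderStatistic_le_iff (y : Fin k → ℝ) {r : ℕ} (hr : 0 < r) (hrk : r ≤ k) (t : ℝ) :
    orderStatistic y r ≤ t ↔ r ≤ (Finset.univ.filter fun j => y j ≤ t).card := by
  set S : Set ℝ := {t : ℝ | r ≤ (Finset.univ.filter fun j => y j ≤ t).card} with hS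
  have hup : ∀ s ∈ S, ∀ t, s ≤ t → t ∈ S := by
    intro s hs t hst
    exact le_trans (show r ≤ _ from hs) (Finset.card_le_card
      (Finset.monotone_filter_right _ fun j _ (hj : y j ≤ s) => hj.trans hst))
  have hk : 0 < k := by omega
  have hne : (Finset.univ : Finset (Fin k)).Nonempty := ⟨⟨0, hk⟩, Finset.mem_univ _⟩
  have hnonempty : S.Nonempty := by
    refine ⟨Finset.univ.sup' hne y, ?_⟩
    have : (Finset.univ.filter fun j => y j ≤ Finset.univ.sup' hne y) = Finset.univ :=
      Finset.filter_true_of_mem fun j hj => Finset.le_sup' y hj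
    rw [hS, mem_ofPred_eq, this, Finset.card_univ, Fintype.card_fin]
    exact hrk
  have hbdd : BddBelow S := by
    refine ⟨Finset.univ.inf' hne y, fun s hs => ?_⟩
    have hpos : 0 < (Finset.univ.filter fun j => y j ≤ s).card :=
      lt_of_lt_of_le hr (show r ≤ _ from hs)
    obtain ⟨j, hj⟩ := Finset.card_pos.mp hpos
    exact (Finset.inf'_le y (Finset.mem_univ j)).trans (Finset.mem_filter.mp hj).2
  have hclosed : IsClosed S := by
    have : S = ⋃ A ∈ (Finset.univ.powerset.filter fun A : Finset (Fin k) => r ≤ A.card),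
        {t : ℝ | ∀ j ∈ A, y j ≤ t} := by
      ext t
      simp only [hS, mem_ofPred_eq, mem_iUnion, Finset.mem_filter, Finset.mem_powerset,
        exists_prop]
      constructor
      · intro h
        exact ⟨_, ⟨Finset.filter_subset _ _, h⟩, fun j hj => (Finset.mem_filter.mp hj).2⟩
      · rintro ⟨A, ⟨-, hA⟩, h⟩
        exact hA.trans (Finset.card_le_card fun j hj =>
          Finset.mem_filter.mpr ⟨Finset.mem_univ j, h j hj⟩)
    rw [this]
    refine Set.Finite.isClosed_biUnion (Finset.finite_toSet _) fun A _ => ?_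
    have : {t : ℝ | ∀ j ∈ A, y j ≤ t} = ⋂ j ∈ A, Ici (y j) := by ext t; simp
    rw [this]
    exact isClosed_biInter fun j _ => isClosed_Ici
  have hmem : sInf S ∈ S := hclosed.csInf_mem hnonempty hbdd
  exact ⟨fun h => hup _ hmem t h, fun h => csInf_le hbdd h⟩

/-- The probability of at least `r` successes in `k` independent trials is an upper binomial tail. -/
lemma measureReal_pi_le_card_filter (κ : Measure ℝ) [IsProbabilityMeasure κ] {p : ℝ → Prop}
    [DecidablePred p] (hs : MeasurableSet {y | p y}) (r : ℕ) :
    (Measure.pi fun _ : Fin k => κ).real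
        {x | r ≤ (Finset.univ.filter fun j => p (x j)).card} =
      ∑ j ∈ Finset.range (k + 1), if r ≤ j then
        (k.choose j : ℝ) * κ.real {y | p y} ^ j * (1 - κ.real {y | p y}) ^ (k - j) else 0 := by
  classical
  set s : Set ℝ := {y | p y} with hsdef
  have hset : {x : Fin k → ℝ | r ≤ (Finset.univ.filter fun j => p (x j)).card} =
      ⋃ A ∈ (Finset.univ.powerset.filter fun A : Finset (Fin k) => r ≤ A.card),
        univ.pi (fun j => if j ∈ A then s else sᶜ) := by
    ext x
    simp only [mem_ofPred_eq, mem_iUnion, Finset.mem_filter, Finset.mem_powerset, exists_prop]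
    constructor
    · intro h
      refine ⟨_, ⟨Finset.filter_subset _ _, h⟩, fun j _ => ?_⟩
      by_cases hj : p (x j) <;> simp [hsdef, hj]
    · rintro ⟨A, ⟨-, hA⟩, h⟩
      refine hA.trans (Finset.card_le_card fun j hj => ?_)
      have := h j (mem_univ j)
      simp only [if_pos hj] at this
      exact Finset.mem_filter.mpr ⟨Finset.mem_univ j, this⟩
  have hmeas : ∀ A : Finset (Fin k), MeasurableSet
      (univ.pi (fun j => if j ∈ A then s else sᶜ)) := by
    intro A
    refine MeasurableSet.univ_pi fun j => ?_
    split_ifs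
    exacts [hs, hs.compl]
  rw [hset, measureReal_biUnion_finset ?_ (fun A _ => hmeas A)]
  · have hA : ∀ A : Finset (Fin k), (Measure.pi fun _ : Fin k => κ).real
        (univ.pi (fun j => if j ∈ A then s else sᶜ)) =
        κ.real s ^ A.card * (1 - κ.real s) ^ (k - A.card) := by
      intro A
      rw [Measure.real, Measure.pi_pi, ENNReal.toReal_prod]
      have : ∀ j, (κ (if j ∈ A then s else sᶜ)).toReal =
          if j ∈ A then κ.real s else 1 - κ.real s := by
        intro j
        split_ifs
        · rfl
        · exact probReal_compl_eq_one_sub hs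
      simp only [this]
      rw [Finset.prod_ite, Finset.prod_const, Finset.prod_const]
      congr 2
      · congr 1; ext; simp
      · rw [← Finset.compl_filter, Finset.card_compl, Fintype.card_fin]
        congr 2; ext; simp
    simp only [hA]
    rw [Finset.sum_filter]
    have := Finset.sum_powerset_apply_card
      (fun j => if r ≤ j then κ.real s ^ j * (1 - κ.real s) ^ (k - j) else 0)
      (x := (Finset.univ : Finset (Fin k)))
    rw [this, Finset.card_univ, Fintype.card_fin]
    refine Finset.sum_congr rfl fun j _ => ?_
    split_ifs
    · rw [nsmul_eq_mul, mul_assoc]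
    · simp
  · intro A _ B _ hAB
    rw [Function.onFun, Set.disjoint_left]
    intro x hxA hxB
    refine hAB (Finset.ext fun j => ?_)
    have h1 := hxA j (mem_univ j)
    have h2 := hxB j (mem_univ j)
    by_cases hjA : j ∈ A <;> by_cases hjB : j ∈ B <;> simp_all

lemma measurable_orderStatistic_abs {r : ℕ} (hr : 0 < r) (hrk : r ≤ k) :
    Measurable (fun x : Fin k → ℝ => orderStatistic (fun j => |x j|) r) := by
  refine measurable_of_Iic fun z => ?_
  have : (fun x : Fin k → ℝ => orderStatistic (fun j => |x j|) r) ⁻¹' Iic z =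
      {x | r ≤ (Finset.univ.filter fun j => |x j| ≤ z).card} := by
    ext x
    exact orderStatistic_le_iff (fun j => |x j|) hr hrk z
  rw [this]
  have hm : Measurable fun x : Fin k → ℝ => (Finset.univ.filter fun j => |x j| ≤ z).card := by
    simp only [Finset.card_filter]
    refine Finset.measurable_sum _ fun j _ => ?_
    exact Measurable.ite (measurableSet_le (by fun_prop) (by fun_prop)) measurable_const
      measurable_const
  exact measurableSet_le measurable_const hm

end OrderStatistic

section BetaCDF

lemma derivative_sum_bernsteinPolynomial (n r : ℕ) (hr : r ≤ n) :
    Polynomial.derivative (∑ j ∈ Finset.Ico r (n + 1), bernsteinPolynomial ℝ (n + 1) (j + 1)) =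
      (n + 1) * bernsteinPolynomial ℝ n r := by
  rw [Polynomial.derivative_sum]
  simp only [bernsteinPolynomial.derivative_succ_aux]
  rw [← Finset.mul_sum, Finset.sum_Ico_eq_sum_range]
  have := Finset.sum_range_sub' (fun i => bernsteinPolynomial ℝ n (r + i)) (n + 1 - r)
  simp only [← add_assoc] at this
  rw [this, add_zero, show r + (n + 1 - r) = n + 1 by omega,
    bernsteinPolynomial.eq_zero_of_lt ℝ (Nat.lt_succ_self n), sub_zero]

lemma betaPDFReal_eq_eval_bernsteinPolynomial {n r : ℕ} (hr : r ≤ n) {x : ℝ} (hx : x ∈ Ioo 0 1) :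
    betaPDFReal ((r : ℝ) + 1) ((n : ℝ) - r + 1) x =
      (n + 1) * (bernsteinPolynomial ℝ n r).eval x := by
  rw [betaPDFReal, if_pos (show 0 < x ∧ x < 1 from hx), beta, ← Nat.cast_sub hr, add_sub_cancel_right, add_sub_cancel_right,
    Real.rpow_natCast, Real.rpow_natCast, Real.Gamma_nat_eq_factorial,
    Real.Gamma_nat_eq_factorial,
    show (r : ℝ) + 1 + (((n - r : ℕ) : ℝ) + 1) = ((n + 1 : ℕ) : ℝ) + 1 by
      push_cast [Nat.cast_sub hr]; ring,
    Real.Gamma_nat_eq_factorial, Nat.factorial_succ]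
  simp only [bernsteinPolynomial, Polynomial.eval_mul, Polynomial.eval_pow, Polynomial.eval_X,
    Polynomial.eval_sub, Polynomial.eval_one, Polynomial.eval_natCast]
  rw [Nat.cast_choose ℝ hr]
  have h1 := (Nat.cast_ne_zero (R := ℝ)).mpr (Nat.factorial_ne_zero r)
  have h2 := (Nat.cast_ne_zero (R := ℝ)).mpr (Nat.factorial_ne_zero (n - r))
  have h3 := (Nat.cast_ne_zero (R := ℝ)).mpr (Nat.factorial_ne_zero n)
  push_cast
  field_simp

/-- The distribution function of a beta law with integer parameters is an upper binomial tail. -/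
lemma measureReal_betaMeasure_Iic {k r : ℕ} (hr : 0 < r) (hrk : r ≤ k) {t : ℝ}
    (ht : t ∈ Ico 0 1) :
    (betaMeasure (r : ℝ) ((k : ℝ) - r + 1)).real (Iic t) =
      ∑ j ∈ Finset.range (k + 1), if r ≤ j then
        (k.choose j : ℝ) * t ^ j * (1 - t) ^ (k - j) else 0 := by
  obtain ⟨r, rfl⟩ : ∃ r', r = r' + 1 := ⟨r - 1, by omega⟩
  obtain ⟨n, rfl⟩ : ∃ n', k = n' + 1 := ⟨k - 1, by omega⟩
  have hrn : r ≤ n := by omega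
  have hcast : ((n + 1 : ℕ) : ℝ) - ((r + 1 : ℕ) : ℝ) + 1 = (n : ℝ) - r + 1 := by push_cast; ring
  rw [hcast, Nat.cast_succ]
  have ha : (0 : ℝ) < r + 1 := by positivity
  have hb : (0 : ℝ) < (n : ℝ) - r + 1 := by
    have : (r : ℝ) ≤ n := by exact_mod_cast hrn
    linarith
  set Φ := ∑ j ∈ Finset.Ico r (n + 1), bernsteinPolynomial ℝ (n + 1) (j + 1) with hΦ
  have hder : ∀ x : ℝ, HasDerivAt (fun x => Φ.eval x)
      ((n + 1) * (bernsteinPolynomial ℝ n r).eval x) x := by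
    intro x
    have := Φ.hasDerivAt x
    rw [hΦ, derivative_sum_bernsteinPolynomial n r hrn] at this
    simpa using this
  have hΦ0 : Φ.eval 0 = 0 := by
    rw [hΦ, Polynomial.eval_finsetSum]
    refine Finset.sum_eq_zero fun j _ => ?_
    rw [bernsteinPolynomial.eval_at_0, if_neg (Nat.succ_ne_zero j)]
  have h1 : (betaMeasure ((r : ℝ) + 1) ((n : ℝ) - r + 1)).real (Iic t) = Φ.eval t := by
    rw [← integral_indicator_one measurableSet_Iic, integral_betaMeasure ha hb]
    have : (fun x => betaPDFReal ((r : ℝ) + 1) ((n : ℝ) - r + 1) x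
          * (Iic t).indicator (1 : ℝ → ℝ) x) =
        (Ioc 0 t).indicator fun x => (n + 1) * (bernsteinPolynomial ℝ n r).eval x := by
      funext x
      by_cases hx : x ∈ Ioc 0 t
      · rw [indicator_of_mem hx, indicator_of_mem (show x ∈ Iic t from hx.2), Pi.one_apply,
          mul_one, betaPDFReal_eq_eval_bernsteinPolynomial hrn ⟨hx.1, hx.2.trans_lt ht.2⟩]
      · rw [indicator_of_notMem hx]
        by_cases hxt : x ≤ t
        · have hx0 : ¬ (0 < x ∧ x < 1) := fun h => hx ⟨h.1, hxt⟩
          rw [betaPDFReal, if_neg hx0, zero_mul]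
        · rw [indicator_of_notMem (show x ∉ Iic t from hxt), mul_zero]
    rw [this, integral_indicator measurableSet_Ioc, ← intervalIntegral.integral_of_le ht.1,
      intervalIntegral.integral_eq_sub_of_hasDerivAt (fun x _ => hder x)
        (Continuous.intervalIntegrable (by fun_prop) _ _), hΦ0, sub_zero]
  rw [h1, hΦ, Polynomial.eval_finsetSum, Finset.sum_range_succ', if_neg (by omega), add_zero,
    ← Finset.sum_filter_add_sum_filter_not (Finset.range (n + 1)) (fun j => r ≤ j)]
  rw [Finset.sum_eq_zero (s := (Finset.range (n + 1)).filter fun j => ¬ r ≤ j)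
    (fun j hj => by
      rw [if_neg]
      have := (Finset.mem_filter.mp hj).2
      omega), add_zero]
  have hfilter : (Finset.range (n + 1)).filter (fun j => r ≤ j) = Finset.Ico r (n + 1) := by
    ext j; simp; omega
  rw [hfilter]
  refine Finset.sum_congr rfl fun j hj => ?_
  rw [if_pos (by have := (Finset.mem_Ico.mp hj).1; omega)]
  simp [bernsteinPolynomial]

end BetaCDF

namespace IsStableLaw

variable {α β F : ℝ} {μ : Measure ℝ}

lemma aemeasurable_absQuantile (hμ : IsStableLaw α β F μ) (hα : 0 < α) (hα1 : α ≠ 1) (hF : 0 < F)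
    (a b : ℝ) : AEMeasurable (absQuantile μ) (betaMeasure a b) := by
  rw [← Measure.restrict_eq_self_of_ae_mem (ae_mem_Ioo_betaMeasure a b)]
  refine aemeasurable_restrict_of_monotoneOn measurableSet_Ioo fun u hu v hv huv => ?_
  rw [hμ.absQuantile_le_iff hα hα1 hF hu, hμ.absCDF_absQuantile hα hα1 hF hv]
  exact huv

/-- The order statistics of the absolute values of independent stable variables are the
quantile transforms of the beta distributed order statistics of uniform variables. -/
lemma map_orderStatistic_abs_pi (hμ : IsStableLaw α β F μ) (hα : 0 < α) (hα1 : α ≠ 1)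
    (hF : 0 < F) {k r : ℕ} (hr : 0 < r) (hrk : r ≤ k) :
    (Measure.pi fun _ : Fin k => μ).map (fun x => orderStatistic (fun j => |x j|) r) =
      (betaMeasure (r : ℝ) ((k : ℝ) - r + 1)).map (absQuantile μ) := by
  have := hμ.isProbabilityMeasure
  have hb : (0 : ℝ) < (k : ℝ) - r + 1 := by
    have : (r : ℝ) ≤ k := by exact_mod_cast hrk
    linarith
  have := isProbabilityMeasureBeta (show (0 : ℝ) < r by exact_mod_cast hr) hb
  have hT := measurable_orderStatistic_abs hr hrk
  have hQ := hμ.aemeasurable_absQuantile hα hα1 hF (r : ℝ) ((k : ℝ) - r + 1)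
  have := Measure.isProbabilityMeasure_map (μ := Measure.pi fun _ : Fin k => μ) hT.aemeasurable
  refine Measure.ext_of_Iic _ _ fun z => ?_
  rw [Measure.map_apply hT measurableSet_Iic, Measure.map_apply_of_aemeasurable hQ
    measurableSet_Iic]
  have h1 : (betaMeasure (r : ℝ) ((k : ℝ) - r + 1)) (absQuantile μ ⁻¹' Iic z) =
      (betaMeasure (r : ℝ) ((k : ℝ) - r + 1)) (Iic (absCDF μ z)) := by
    refine measure_congr ?_
    filter_upwards [ae_mem_Ioo_betaMeasure (r : ℝ) ((k : ℝ) - r + 1)] with u hu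
    exact propext (hμ.absQuantile_le_iff hα hα1 hF hu z)
  have h2 : (fun x : Fin k → ℝ => orderStatistic (fun j => |x j|) r) ⁻¹' Iic z =
      {x | r ≤ (Finset.univ.filter fun j => |x j| ≤ z).card} := by
    ext x
    exact orderStatistic_le_iff (fun j => |x j|) hr hrk z
  rw [h1, h2, ← ENNReal.toReal_eq_toReal_iff' (measure_ne_top _ _) (measure_ne_top _ _)]
  change Measure.real _ _ = Measure.real _ _
  rw [measureReal_pi_le_card_filter μ (p := fun y => |y| ≤ z) (measurableSet_le (by fun_prop) (by fun_prop)),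
    measureReal_betaMeasure_Iic (t := absCDF μ z) hr hrk
      ⟨measureReal_nonneg, hμ.absCDF_lt_one hα hα1 hF z⟩]
  rfl

lemma absQuantile_map_mul {ν : Measure ℝ} (hμ : IsStableLaw α β F μ) (hν : IsStableLaw α β 1 ν)
    (hα : 0 < α) (hα1 : α ≠ 1) (hF : 0 < F) {u : ℝ} (hu : u ∈ Ioo 0 1) :
    absQuantile μ u = F ^ (1 / α) * absQuantile ν u := by
  have hs : 0 < F ^ (1 / α) := Real.rpow_pos_of_pos hF _
  have hcdf : absCDF μ (F ^ (1 / α) * absQuantile ν u) = u := by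
    rw [absCDF, hμ.eq_map_mul hν hα hF, map_measureReal_apply (by fun_prop)
      (measurableSet_le (by fun_prop) (by fun_prop))]
    refine Eq.trans ?_ (hν.absCDF_absQuantile hα hα1 one_pos hu)
    rw [absCDF]
    congr 1
    ext x
    simp only [mem_preimage, mem_ofPred_eq, abs_mul, abs_of_pos hs]
    exact mul_le_mul_iff_right₀ hs
  exact ((hμ.absCDF_eq_iff hα hα1 hF hu _).mp hcdf).symm

end IsStableLaw

/-! ### Variance of the quantile estimator -/

theorem lemma3 (α F q : ℝ) (hα0 : 0 < α) (hα2 : α ≤ 2) (hα1 : α ≠ 1) (hF : 0 < F)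
    (hq0 : 0 < q) (hq1 : q < 1) (ν μ : Measure ℝ)
    (hν : IsStableLaw α 1 1 ν) (hμ : IsStableLaw α 1 F μ) :
    (0 < absQuantile ν q ∧
      (∀ z : ℝ, absCDF ν z = q ↔ z = absQuantile ν q) ∧
      DifferentiableAt ℝ (absCDF ν) (absQuantile ν q) ∧
      0 < absDensity ν (absQuantile ν q)) ∧
    ∃ (C : ℝ) (K : ℕ), ∀ k : ℕ, K ≤ k →
      ∀ (Ω : Type*) [MeasurableSpace Ω] (P : Measure Ω) [IsProbabilityMeasure P]
        (x : Fin k → Ω → ℝ), iIndepFun x P → (∀ j, HasLaw (x j) μ P) →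
        MemLp (fun ω => quantileEstimator α q ν (fun j => x j ω)) 2 P ∧
        |variance (fun ω => quantileEstimator α q ν (fun j => x j ω)) P -
            F ^ 2 / (k : ℝ) * ((q - q ^ 2) * α ^ 2 /
              (absDensity ν (absQuantile ν q) ^ 2 * absQuantile ν q ^ 2))| ≤
          C / (k : ℝ) ^ 2 := by
  have hq : q ∈ Ioo (0 : ℝ) 1 := ⟨hq0, hq1⟩
  have hW : 0 < absQuantile ν q := hν.absQuantile_pos hα0 hα1 one_pos hq
  have hD : 0 < absDensity ν (absQuantile ν q) := hν.absDensity_pos hα0 hα1 one_pos hW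
  refine ⟨⟨hW, hν.absCDF_eq_iff hα0 hα1 one_pos hq,
    (hν.hasDerivAt_absCDF hα0 one_pos hW).differentiableAt, hD⟩, ?_⟩
  obtain ⟨c, B, hB, hexp⟩ := hν.exists_quantile_expansion hα0 hα1 one_pos hq
  obtain ⟨ε, K, hK, hmom⟩ := exists_beta_moment_bounds hq
  set W := absQuantile ν q with hWdef
  set D := absDensity ν W with hDdef
  set a := α / (D * W) with ha
  set h : ℝ → ℝ := fun u => (absQuantile ν u / W) ^ α with hh
  refine ⟨F ^ 2 * (a ^ 2 * ε + 2 * |a * c| * ε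
    + (c ^ 2 + 2 * |a| * B + 2 * |c| * B + B ^ 2) * ε + ((|a| + |c| + B) * ε) ^ 2), K, ?_⟩
  intro k hk Ω _ P _ x hindep hlaw
  have hμp := hμ.isProbabilityMeasure
  have hk0 : (0 : ℝ) < k := by exact_mod_cast hK.trans_le hk
  set r := ⌈q * (k : ℝ)⌉₊ with hr
  have hr0 : 0 < r := Nat.ceil_pos.mpr (mul_pos hq0 hk0)
  have hrk : r ≤ k := Nat.ceil_le.mpr (by nlinarith)
  have hb : (0 : ℝ) < (k : ℝ) - r + 1 := by
    have : (r : ℝ) ≤ k := by exact_mod_cast hrk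
    linarith
  obtain ⟨h1, h2, h3, hi2, hi4, hw2, hw4⟩ := hmom k hk
  set m := betaMeasure (r : ℝ) ((k : ℝ) - r + 1) with hm
  have hmp : IsProbabilityMeasure m := isProbabilityMeasureBeta (by exact_mod_cast hr0) hb
  have hhm : AEStronglyMeasurable h m :=
    (((hν.aemeasurable_absQuantile hα0 hα1 one_pos _ _).div_const W).pow_const
      α).aestronglyMeasurable
  obtain ⟨hL, hvar⟩ := memLp_and_abs_variance_sub_le (ae_mem_Ioo_betaMeasure _ _) hhm hq hB
    hexp h1 h2 h3 hi2 hi4 hw2 hw4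
  -- the law of the sample quantile
  have hX : ∀ j, AEMeasurable (x j) P := fun j => (hlaw j).aemeasurable
  have hpi : P.map (fun ω j => x j ω) = Measure.pi fun _ => μ := by
    rw [(iIndepFun_iff_map_fun_eq_pi_map hX).mp hindep]
    congr 1
    funext j
    exact (hlaw j).map_eq
  have hT := measurable_orderStatistic_abs hr0 hrk
  have hXm : AEMeasurable (fun ω j => x j ω) P := aemeasurable_pi_lambda _ hX
  have hTX : AEMeasurable (fun ω => sampleQuantile q fun j => |x j ω|) P :=
    hT.comp_aemeasurable hXm
  have hQ := hμ.aemeasurable_absQuantile hα0 hα1 hF (r : ℝ) ((k : ℝ) - r + 1)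
  have hmap : P.map (fun ω => sampleQuantile q fun j => |x j ω|) = m.map (absQuantile μ) := by
    rw [hm, ← hμ.map_orderStatistic_abs_pi hα0 hα1 hF hr0 hrk, ← hpi,
      AEMeasurable.map_map_of_aemeasurable hT.aemeasurable hXm]
    rfl
  set e : ℝ → ℝ := fun t => (t / W) ^ α with he
  have hem : Measurable e := (measurable_id.div_const W).pow_const α
  have hest : (fun ω => quantileEstimator α q ν fun j => x j ω) =
      e ∘ fun ω => sampleQuantile q fun j => |x j ω| := rfl
  have hscale : e ∘ absQuantile μ =ᵐ[m] fun u => F * h u := by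
    filter_upwards [ae_mem_Ioo_betaMeasure (r : ℝ) ((k : ℝ) - r + 1)] with u hu
    have hQu := hν.absQuantile_pos hα0 hα1 one_pos hu
    simp only [he, hh, Function.comp_apply]
    rw [hμ.absQuantile_map_mul hν hα0 hα1 hF hu, mul_div_assoc,
      Real.mul_rpow (by positivity) (by positivity), ← Real.rpow_mul hF.le,
      one_div_mul_cancel hα0.ne', Real.rpow_one]
  constructor
  · rw [hest, ← memLp_map_measure_iff hem.aestronglyMeasurable hTX, hmap,
      memLp_map_measure_iff hem.aestronglyMeasurable hQ, memLp_congr_ae hscale]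
    exact hL.const_mul F
  · rw [hest, ← variance_map hem.aemeasurable hTX, hmap, variance_map hem.aemeasurable hQ,
      variance_congr hscale, variance_const_mul]
    have hlead : F ^ 2 / (k : ℝ) * ((q - q ^ 2) * α ^ 2 / (D ^ 2 * W ^ 2)) =
        F ^ 2 * (a ^ 2 * (q * (1 - q) * (1 / k))) := by
      rw [ha]; field_simp
    rw [hlead, ← mul_sub, abs_mul, abs_of_nonneg (sq_nonneg F)]
    calc _ ≤ F ^ 2 * _ := mul_le_mul_of_nonneg_left hvar (sq_nonneg F)
      _ = _ := by rw [one_div, inv_pow]; ring
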